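/- Let $X>0$. A pair $(u,v)$ of real functions solves the Prandtl equation (with outer flow $1$) globally in time on $[0,X]$ if $$\partial_t u+u\,\partial_x u+v\,\partial_y u-\partial_y^2u=0,\qquad \partial_x u+\partial_y v=0\qquad\text{for } t>0,\ 0<x\le X,\ y>0,$$ $u|_{y=0}=v|_{y=0}=0$ and $\lim_{y\to+\infty}u(t,x,y)=1$; write $u_0=u|_{t=0}$, $u_1=u|_{x=0}$ for the initial and inflow data. Such a (classical) solution with $\partial_y u>0$ has the Crocco transform $w(\tau,\xi,\eta)$, $0\le\eta<1$, defined by $w(t,x,u(t,x,y))=\partial_y u(t,x,y)$. It is a *global Oleinik monotone solution* if $w\in C^2([0,\infty)\times[0,X]\times[0,1))\cap C^3((0,\infty)\times(0,X]\times(0,1))$ and, as $\eta\to1$, locally uniformly in $(\tau,\xi)\in[0,\infty)\times[0,X]$, one has $w\to0$, $\partial_\xi w\to0$, $\partial_\tau w\to 0$ and $w\,\partial_\eta^2w\to l(\tau,\xi)$ for some continuous function $l$. It is *steady* if $u$ does not depend on $t$. For $c_0\in(0,1)$, $\mu\in(0,\frac1{100})$, $\alpha_0\in(0,1)$, $C_1>0$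 and $\beta>0$ put $$b=\tfrac{c_0}{4}e^{-\beta X}e^{-8/3},\qquad K=e^X\max\{2,2C_1^{1/\alpha_0-1}\},$$ $$\delta=\min\Big\{\tfrac1{10}\min_{\alpha\in[\alpha_0/2,\alpha_0]}\alpha(1-\alpha)b^2,\ \tfrac1{321e^X},\ \tfrac{\min\{1,C_1\}}{b\,2^{\alpha_0}}\Big\},$$ and say that $u$ has *admissible data* (for these constants) if, at all points of $[0,\infty)\times[0,X]\times[0,1)$ with $\tau=0$ or $\xi=0$, $$c_0(1-\eta)\le w\le c_0^{-1}(1-\eta)\sqrt{-\ln(\mu(1-\eta))},$$ $$-C_1(1-\eta)^{\alpha_0}\le\partial_\xi w+\partial_\tau w\le\frac{(\delta b)^{1/\alpha_0}}{K}(1-\eta),\qquad -C_1(1-\eta)^{\alpha_0}\le\partial_\tau w\le b\,\delta\,(1-\eta)^{\alpha_0}.$$ **Theorem.** For all $\mu\in(0,\frac1{100})$, $c_0\in(0,1)$ and $X>0$ there is $\beta>0$, depending only on $\mu,c_0,X$, such that the following holds for all $\alpha_0\in(0,1)$ and $C_1>0$. Let $\bar u$ be a steady and $u$ a global Oleinik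 monotone solution on $[0,X]$, with Crocco transforms $\bar w$ and $w$, both with admissible data for the constants $\mu,c_0,X,\alpha_0,C_1,\beta$, and suppose that $\partial_\eta^2\bar w\le0$ for $0<\xi\le X$, $0<\eta<1$. (i) *Orbital stability.* For every $\epsilon>0$ there is $\delta_\epsilon>0$, depending only on $\epsilon,\mu,\alpha_0,c_0,C_1,X$, such that if $$\|\partial_yu_1-\partial_y\bar u_1\|_{L^\infty([0,\infty)\times[0,\infty))}\le\delta_\epsilon,\qquad \|\partial_yu_0-\partial_y\bar u_0\|_{L^\infty([0,X]\times[0,\infty))}\le\delta_\epsilon,$$ then $\|u-\bar u\|_{L^\infty([0,\infty)\times[0,X]\times[0,\infty))}\le\epsilon$. (ii) *Asymptotic stability.* Let $\beta_0\in(0,b^2\alpha_0(1-\alpha_0))$ and $C_2>0$, and suppose that $w_1=w|_{\xi=0}$ and $\bar w_1=\bar w|_{\xi=0}$ satisfy $$|w_1(\tau,\eta)-\bar w_1(\eta)|\le C_2e^{-\beta_0\tau}(1-\eta)^{\alpha_0}\qquad\text{for }\tau\ge0,\ 0\le\eta<1 .$$ Then for every $y_0>0$ there is a constant $C>0$, depending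 only on $y_0,\alpha_0,C_2,\mu,c_0,X$, such that $$\|u(t)-\bar u\|_{L^\infty([0,X]\times[0,y_0])}\le C e^{-\beta_0t}\qquad\text{for all }t\ge0;$$ moreover $\|u(t)-\bar u\|_{L^\infty([0,X]\times[0,\infty))}\to0$ as $t\to+\infty$. -/

import Mathlib

open Set Filter Topology

noncomputable section

namespace Prandtl

/-- Partial derivative in the time variable on `[0, ∞)` (one-sided at `0`). -/
def dT (f : ℝ → ℝ → ℝ → ℝ) (t x y : ℝ) : ℝ :=
  derivWithin (fun s => f s x y) (Ici 0) t

/-- Partial derivative in the tangential variable on `[0, X]` (one-sided at the end points). -/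
def dX (X : ℝ) (f : ℝ → ℝ → ℝ → ℝ) (t x y : ℝ) : ℝ :=
  derivWithin (fun s => f t s y) (Icc 0 X) x

/-- Partial derivative in the third variable (`y`, or `η` in Crocco variables), one-sided at `0`.
At `0 ≤ η < 1` it only depends on the values of `f` at third arguments in `[0, 1)`. -/
def dY (f : ℝ → ℝ → ℝ → ℝ) (t x y : ℝ) : ℝ :=
  derivWithin (fun s => f t x s) (Ici 0) y

/-- Second partial derivative in the third variable. -/
def dYY (f : ℝ → ℝ → ℝ → ℝ) : ℝ → ℝ → ℝ → ℝ := dY (dY f)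

/-- A function of three variables as a function on `ℝ × ℝ × ℝ`. -/
def unc (f : ℝ → ℝ → ℝ → ℝ) (p : ℝ × ℝ × ℝ) : ℝ := f p.1 p.2.1 p.2.2

/-- The closed physical domain `[0, ∞) × [0, X] × [0, ∞)`. -/
def physDomain (X : ℝ) : Set (ℝ × ℝ × ℝ) := Ici 0 ×ˢ Icc 0 X ×ˢ Ici 0

/-- The Crocco domain `[0, ∞) × [0, X] × [0, 1)`, closed except for the edge `η = 1`. -/
def croccoDomain (X : ℝ) : Set (ℝ × ℝ × ℝ) := Ici 0 ×ˢ Icc 0 X ×ˢ Ico 0 1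

/-- The set `(0, ∞) × (0, X] × (0, 1)`. -/
def croccoInterior (X : ℝ) : Set (ℝ × ℝ × ℝ) := Ioi 0 ×ˢ Ioc 0 X ×ˢ Ioo 0 1

/-- `(u, v)` is a global-in-time classical solution of the Prandtl equation with outer flow `1`:
`∂ₜu + u ∂ₓu + v ∂_y u - ∂_y² u = 0` and `∂ₓu + ∂_y v = 0` for `t > 0`, `0 < x ≤ X`, `y > 0`,
with `u = v = 0` at `y = 0` and `u → 1` as `y → ∞`. The initial and inflow data are the
restrictions of `u` to `t = 0` and to `x = 0`. -/
structure IsPrandtlSolution (X : ℝ) (u v : ℝ → ℝ → ℝ → ℝ) : Prop where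
  contDiffOn_u : ContDiffOn ℝ 2 (unc u) (physDomain X)
  continuousOn_v : ∀ t > 0, ∀ x ∈ Ioc 0 X, ContinuousOn (v t x) (Ici 0)
  momentum : ∀ t > 0, ∀ x ∈ Ioc 0 X, ∀ y > 0,
    dT u t x y + u t x y * dX X u t x y + v t x y * dY u t x y - dYY u t x y = 0
  divergence : ∀ t > 0, ∀ x ∈ Ioc 0 X, ∀ y > 0, HasDerivAt (v t x) (-dX X u t x y) y
  u_wall : ∀ t ≥ 0, ∀ x ∈ Icc 0 X, u t x 0 = 0
  v_wall : ∀ t > 0, ∀ x ∈ Ioc 0 X, v t x 0 = 0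
  u_far : ∀ t ≥ 0, ∀ x ∈ Icc 0 X, Tendsto (u t x) atTop (𝓝 1)

/-- `g` tends to `l (τ, ξ)` as `η → 1⁻`, locally uniformly in `(τ, ξ) ∈ [0, ∞) × [0, X]`, with `l`
continuous; that is, `g` extends continuously by `l` to the edge `η = 1`. -/
def HasEdgeLimit (X : ℝ) (g : ℝ → ℝ → ℝ → ℝ) (l : ℝ → ℝ → ℝ) : Prop :=
  ∀ τ ≥ 0, ∀ ξ ∈ Icc 0 X,
    Tendsto (unc g) (𝓝[croccoDomain X] (τ, ξ, 1)) (𝓝 (l τ ξ))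

/-- `u` is a global Oleinik monotone solution of the Prandtl equation on `[0, X]`, and `w` is its
Crocco transform, `w(t, x, u(t, x, y)) = ∂_y u(t, x, y)`. As `u(t, x, ·)` maps `[0, ∞)` bijectively
onto `[0, 1)`, the identity `crocco` determines `w` on the Crocco domain; there the Crocco equation
`-∂_τ w - η ∂_ξ w + w² ∂_η² w = 0` and the condition `w ∂_η w = 0` at `η = 0` are consequences of
the Prandtl equation for `u`. The `C²` regularity of `u` is a consequence of that of `w`. -/
structure IsOleinikSolution (X : ℝ) (u w : ℝ → ℝ → ℝ → ℝ) : Prop where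
  prandtl : ∃ v, IsPrandtlSolution X u v
  monotone : ∀ t ≥ 0, ∀ x ∈ Icc 0 X, ∀ y ≥ 0, 0 < dY u t x y
  crocco : ∀ t ≥ 0, ∀ x ∈ Icc 0 X, ∀ y ≥ 0, w t x (u t x y) = dY u t x y
  contDiffOn_two : ContDiffOn ℝ 2 (unc w) (croccoDomain X)
  contDiffOn_three : ContDiffOn ℝ 3 (unc w) (croccoInterior X)
  edge_w : HasEdgeLimit X w (fun _ _ => 0)
  edge_dX : HasEdgeLimit X (dX X w) (fun _ _ => 0)
  edge_dT : HasEdgeLimit X (dT w) (fun _ _ => 0)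
  edge_dYY : ∃ l : ℝ → ℝ → ℝ, HasEdgeLimit X (fun τ ξ η => w τ ξ η * dYY w τ ξ η) l

/-- `b = (c₀ / 4) e^{-β X} e^{-8/3}`. -/
def bConst (c₀ β X : ℝ) : ℝ := c₀ / 4 * Real.exp (-(β * X)) * Real.exp (-(8 / 3))

/-- `K = e^X max {2, 2 C₁^{1/α₀ - 1}}`. -/
def kConst (X α₀ C₁ : ℝ) : ℝ := Real.exp X * max 2 (2 * C₁ ^ (1 / α₀ - 1))

/-- `δ = min {(1/10) min_{α ∈ [α₀/2, α₀]} α (1 - α) b², 1 / (321 e^X), min {1, C₁} / (b 2^{α₀})}`. -/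
def deltaConst (X α₀ C₁ b : ℝ) : ℝ :=
  min (1 / 10 * sInf ((fun α : ℝ => α * (1 - α) * b ^ 2) '' Icc (α₀ / 2) α₀))
    (min (1 / (321 * Real.exp X)) (min 1 C₁ / (b * 2 ^ α₀)))

/-- The conditions on the initial and inflow data, in Crocco variables: on the part
`{τ = 0} ∪ {ξ = 0}` of the boundary,
`c₀ (1 - η) ≤ w ≤ c₀⁻¹ (1 - η) √(-ln (μ (1 - η)))`,
`-C₁ (1 - η)^{α₀} ≤ ∂_ξ w + ∂_τ w ≤ (δ b)^{1/α₀} / K (1 - η)`,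
`-C₁ (1 - η)^{α₀} ≤ ∂_τ w ≤ b δ (1 - η)^{α₀}`. -/
def DataBounds (X μ c₀ α₀ C₁ b : ℝ) (w : ℝ → ℝ → ℝ → ℝ) : Prop :=
  ∀ τ ≥ 0, ∀ ξ ∈ Icc 0 X, ∀ η ∈ Ico (0 : ℝ) 1, (τ = 0 ∨ ξ = 0) →
    (c₀ * (1 - η) ≤ w τ ξ η ∧
      w τ ξ η ≤ c₀⁻¹ * (1 - η) * Real.sqrt (-Real.log (μ * (1 - η)))) ∧
    (-C₁ * (1 - η) ^ α₀ ≤ dX X w τ ξ η + dT w τ ξ η ∧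
      dX X w τ ξ η + dT w τ ξ η
        ≤ (deltaConst X α₀ C₁ b * b) ^ (1 / α₀) / kConst X α₀ C₁ * (1 - η)) ∧
    (-C₁ * (1 - η) ^ α₀ ≤ dT w τ ξ η ∧
      dT w τ ξ η ≤ b * deltaConst X α₀ C₁ b * (1 - η) ^ α₀)

/-- The standing hypotheses of the stability theorem: `ū` is a steady and `u` a global Oleinik
monotone solution, with Crocco transforms `w̄` and `w`; `∂_η² w̄ ≤ 0`; and the data of both
solutions satisfy `DataBounds` with the same constants. -/
structure StabilityHyp (X μ c₀ α₀ C₁ b : ℝ) (ubar wbar : ℝ → ℝ → ℝ)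
    (u w : ℝ → ℝ → ℝ → ℝ) : Prop where
  steady : IsOleinikSolution X (fun _ => ubar) (fun _ => wbar)
  unsteady : IsOleinikSolution X u w
  concave : ∀ ξ ∈ Ioc 0 X, ∀ η ∈ Ioo (0 : ℝ) 1, dYY (fun _ => wbar) 0 ξ η ≤ 0
  data_bar : DataBounds X μ c₀ α₀ C₁ b (fun _ => wbar)
  data : DataBounds X μ c₀ α₀ C₁ b w

end Prandtl

end

open Set Filter Topology

noncomputable section

namespace Prandtl

/-! In Crocco variables the Prandtl system becomes the scalar degenerate equation `∂_τ w + η ∂_ξ w =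
w² ∂_η² w` with `∂_η w = 0` at the wall (`crocco_equation`, `dY_w_wall`), and the proof is
comparison for this equation (`max_principle`). A concave stationary barrier bounds `w` from above
by a multiple of `(1 - η) √(-ln (μ (1 - η)))` (`w_le_barrier`). The subsolution `(c₀ / 3) e^{-β ξ}
(1 - η³)` then gives `w ≥ b (1 - η)` (`lower_bound`, `bConst_mul_le`), with `β` chosen so that the
upper bound makes it a subsolution.

The difference `φ = w - w̄` satisfies `∂_τ φ + η ∂_ξ φ = w² ∂_η² φ + (w + w̄) (∂_η² w̄) φ`.
Concavity of `w̄` makes the zeroth-order coefficient nonpositive, so constants are supersolutions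
and `sup |φ|` is controlled by the data (`abs_diff_le_const`). Since `w² ≥ b² (1 - η)²`, the
function `e^{-κ τ} (1 - η)^α` is also a supersolution for `κ ≤ b² α (1 - α)`, which gives
exponential decay (`abs_diff_le_exp`).

The velocity is recovered from `y = ∫₀^u dη / w`: the gap `|u - ū|` is at most a constant times `sup
|φ|` divided by the square of the larger distance to the outer flow (`velocity_gap`). At bounded
heights this distance is bounded below (`exp_le_one_sub_u`), so the rate survives. Uniformly in `y`,
either this distance is at least `ε`, or both velocities are within `ε` of `1`
(`velocity_gap_uniform`). Closeness of `∂_y u` and `∂_y ū` on the data is converted into closeness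
of `w` and `w̄` by `abs_data_diff_le`. -/

/-- The product `[0, ∞) × [0, X] × S`. -/
def box (X : ℝ) (S : Set ℝ) : Set (ℝ × ℝ × ℝ) := Ici 0 ×ˢ Icc 0 X ×ˢ S

/-- `S` is a relatively open subset of `[0, ∞)`. -/
structure RelOpen (S : Set ℝ) : Prop where
  subset : S ⊆ Ici 0
  mem_nhds : ∀ y ∈ S, S ∈ 𝓝[Ici 0] y

lemma relOpen_Ici : RelOpen (Ici 0) := ⟨subset_rfl, fun _ _ => self_mem_nhdsWithin⟩

lemma relOpen_Ico : RelOpen (Ico 0 1) where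
  subset := fun _ hy => hy.1
  mem_nhds := fun y hy => by
    have : Ico (0 : ℝ) 1 = Iio 1 ∩ Ici 0 := by ext z; simp [and_comm]
    rw [this]
    exact inter_mem (mem_nhdsWithin_of_mem_nhds (Iio_mem_nhds hy.2)) self_mem_nhdsWithin

lemma RelOpen.uniqueDiffOn {S : Set ℝ} (hS : RelOpen S) : UniqueDiffOn ℝ S := fun y hy =>
  (uniqueDiffOn_Ici (0 : ℝ) y (hS.subset hy)).mono_nhds (nhdsWithin_le_of_mem (hS.mem_nhds y hy))

lemma uniqueDiffOn_box {X : ℝ} (hX : 0 < X) {S : Set ℝ} (hS : RelOpen S) :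
    UniqueDiffOn ℝ (box X S) :=
  (uniqueDiffOn_Ici 0).prod ((uniqueDiffOn_Icc hX).prod hS.uniqueDiffOn)

/-! ### One-sided partial derivatives and regularity up to the boundary -/

section Partials

variable {X : ℝ} {S : Set ℝ} {f : ℝ → ℝ → ℝ → ℝ} {t x y : ℝ}

lemma hasDerivWithinAt_fst (hf : DifferentiableOn ℝ (unc f) (box X S))
    (ht : 0 ≤ t) (hx : x ∈ Icc 0 X) (hy : y ∈ S) :
    HasDerivWithinAt (fun s => f s x y)
      (fderivWithin ℝ (unc f) (box X S) (t, x, y) (1, 0, 0)) (Ici 0) t := by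
  have hp : (t, x, y) ∈ box X S := ⟨ht, hx, hy⟩
  have h1 : HasDerivWithinAt (fun s : ℝ => (s, x, y)) (1, 0, 0) (Ici 0) t :=
    (hasDerivWithinAt_id t _).prodMk (hasDerivWithinAt_const t _ (x, y))
  exact (hf _ hp).hasFDerivWithinAt.comp_hasDerivWithinAt t h1
    (fun s hs => show (s, x, y) ∈ box X S from ⟨hs, hx, hy⟩)

lemma hasDerivWithinAt_snd (hf : DifferentiableOn ℝ (unc f) (box X S))
    (ht : 0 ≤ t) (hx : x ∈ Icc 0 X) (hy : y ∈ S) :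
    HasDerivWithinAt (fun s => f t s y)
      (fderivWithin ℝ (unc f) (box X S) (t, x, y) (0, 1, 0)) (Icc 0 X) x := by
  have hp : (t, x, y) ∈ box X S := ⟨ht, hx, hy⟩
  have h1 : HasDerivWithinAt (fun s : ℝ => (t, s, y)) (0, 1, 0) (Icc 0 X) x :=
    (hasDerivWithinAt_const x _ t).prodMk
      ((hasDerivWithinAt_id x _).prodMk (hasDerivWithinAt_const x _ y))
  exact (hf _ hp).hasFDerivWithinAt.comp_hasDerivWithinAt x h1
    (fun s hs => show (t, s, y) ∈ box X S from ⟨ht, hs, hy⟩)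

/-- The slice is defined on `S`, but `dY` differentiates within `[0, ∞)`. Relative openness makes
the two notions agree, so one development serves both `[0, ∞)` and `[0, 1)`. -/
lemma hasDerivWithinAt_trd (hS : RelOpen S) (hf : DifferentiableOn ℝ (unc f) (box X S))
    (ht : 0 ≤ t) (hx : x ∈ Icc 0 X) (hy : y ∈ S) :
    HasDerivWithinAt (fun s => f t x s)
      (fderivWithin ℝ (unc f) (box X S) (t, x, y) (0, 0, 1)) (Ici 0) y := by
  have hp : (t, x, y) ∈ box X S := ⟨ht, hx, hy⟩
  have h1 : HasDerivWithinAt (fun s : ℝ => (t, x, s)) (0, 0, 1) S y :=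
    (hasDerivWithinAt_const y _ t).prodMk
      ((hasDerivWithinAt_const y _ x).prodMk (hasDerivWithinAt_id y _))
  exact ((hf _ hp).hasFDerivWithinAt.comp_hasDerivWithinAt y h1
    (fun s hs => show (t, x, s) ∈ box X S from ⟨ht, hx, hs⟩)).mono_of_mem_nhdsWithin (hS.mem_nhds y hy)

/-- Identifying each partial with a directional value of `fderivWithin` on the box lets regularity
up to the boundary pass to iterated partials. -/
lemma dT_eq (hf : DifferentiableOn ℝ (unc f) (box X S))
    (ht : 0 ≤ t) (hx : x ∈ Icc 0 X) (hy : y ∈ S) :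
    dT f t x y = fderivWithin ℝ (unc f) (box X S) (t, x, y) (1, 0, 0) :=
  (hasDerivWithinAt_fst hf ht hx hy).derivWithin (uniqueDiffOn_Ici 0 t ht)

lemma dX_eq (hX : 0 < X) (hf : DifferentiableOn ℝ (unc f) (box X S))
    (ht : 0 ≤ t) (hx : x ∈ Icc 0 X) (hy : y ∈ S) :
    dX X f t x y = fderivWithin ℝ (unc f) (box X S) (t, x, y) (0, 1, 0) :=
  (hasDerivWithinAt_snd hf ht hx hy).derivWithin (uniqueDiffOn_Icc hX x hx)

lemma dY_eq (hS : RelOpen S) (hf : DifferentiableOn ℝ (unc f) (box X S))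
    (ht : 0 ≤ t) (hx : x ∈ Icc 0 X) (hy : y ∈ S) :
    dY f t x y = fderivWithin ℝ (unc f) (box X S) (t, x, y) (0, 0, 1) :=
  (hasDerivWithinAt_trd hS hf ht hx hy).derivWithin (uniqueDiffOn_Ici 0 y (hS.subset hy))

lemma hasDerivWithinAt_dT (hf : DifferentiableOn ℝ (unc f) (box X S))
    (ht : 0 ≤ t) (hx : x ∈ Icc 0 X) (hy : y ∈ S) :
    HasDerivWithinAt (fun s => f s x y) (dT f t x y) (Ici 0) t := by
  rw [dT_eq hf ht hx hy]; exact hasDerivWithinAt_fst hf ht hx hy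

lemma hasDerivWithinAt_dX (hX : 0 < X) (hf : DifferentiableOn ℝ (unc f) (box X S))
    (ht : 0 ≤ t) (hx : x ∈ Icc 0 X) (hy : y ∈ S) :
    HasDerivWithinAt (fun s => f t s y) (dX X f t x y) (Icc 0 X) x := by
  rw [dX_eq hX hf ht hx hy]; exact hasDerivWithinAt_snd hf ht hx hy

lemma hasDerivWithinAt_dY (hS : RelOpen S) (hf : DifferentiableOn ℝ (unc f) (box X S))
    (ht : 0 ≤ t) (hx : x ∈ Icc 0 X) (hy : y ∈ S) :
    HasDerivWithinAt (f t x) (dY f t x y) (Ici 0) y := by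
  rw [dY_eq hS hf ht hx hy]; exact hasDerivWithinAt_trd hS hf ht hx hy

variable {n : ℕ}

lemma contDiffOn_fderivWithin_box (hX : 0 < X) (hS : RelOpen S)
    (hf : ContDiffOn ℝ (n + 1 : ℕ) (unc f) (box X S)) (e : ℝ × ℝ × ℝ) :
    ContDiffOn ℝ n (fun p => fderivWithin ℝ (unc f) (box X S) p e) (box X S) :=
  (hf.fderivWithin (uniqueDiffOn_box hX hS) (by norm_cast)).clm_apply contDiffOn_const

lemma contDiffOn_dT (hX : 0 < X) (hS : RelOpen S)
    (hf : ContDiffOn ℝ (n + 1 : ℕ) (unc f) (box X S)) :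
    ContDiffOn ℝ n (unc (dT f)) (box X S) :=
  (contDiffOn_fderivWithin_box hX hS hf (1, 0, 0)).congr fun _ hp =>
    dT_eq (hf.differentiableOn (by norm_cast)) hp.1 hp.2.1 hp.2.2

lemma contDiffOn_dX (hX : 0 < X) (hS : RelOpen S)
    (hf : ContDiffOn ℝ (n + 1 : ℕ) (unc f) (box X S)) :
    ContDiffOn ℝ n (unc (dX X f)) (box X S) :=
  (contDiffOn_fderivWithin_box hX hS hf (0, 1, 0)).congr fun _ hp =>
    dX_eq hX (hf.differentiableOn (by norm_cast)) hp.1 hp.2.1 hp.2.2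

lemma contDiffOn_dY (hX : 0 < X) (hS : RelOpen S)
    (hf : ContDiffOn ℝ (n + 1 : ℕ) (unc f) (box X S)) :
    ContDiffOn ℝ n (unc (dY f)) (box X S) :=
  (contDiffOn_fderivWithin_box hX hS hf (0, 0, 1)).congr fun _ hp =>
    dY_eq hS (hf.differentiableOn (by norm_cast)) hp.1 hp.2.1 hp.2.2

end Partials

/-! ### The maximum principle -/

/-- At a maximum over an interval reaching to the left of the point, the one-sided derivative is
nonnegative. -/
lemma deriv_nonneg_of_max_left {g : ℝ → ℝ} {s : Set ℝ} {a c g' : ℝ} (hac : a < c)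
    (hs : Icc a c ⊆ s) (hg : HasDerivWithinAt g g' s c) (hmax : ∀ z ∈ Icc a c, g z ≤ g c) :
    0 ≤ g' := by
  have h := hg.mono hs
  have h1 : HasDerivWithinAt g g' (Iio c) c :=
    (h.mono_of_mem_nhdsWithin (Icc_mem_nhdsLE hac)).mono Iio_subset_Iic_self
  have h2 := (hasDerivWithinAt_iff_tendsto_slope' (by simp)).1 h1
  refine ge_of_tendsto h2 ?_
  filter_upwards [Ioo_mem_nhdsLT hac] with z hz
  rw [slope_def_field]
  exact div_nonneg_of_nonpos (by linarith [hmax z ⟨hz.1.le, hz.2.le⟩]) (by linarith [hz.2])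

/-- The second derivative test on `[0, d)`, including the end point `0` when the derivative is
nonnegative there. -/
lemma snd_deriv_nonpos_of_max {g g₁ : ℝ → ℝ} {c d g₂ : ℝ} (hc : 0 ≤ c) (hcd : c < d)
    (hg : ∀ z ∈ Ico 0 d, HasDerivWithinAt g (g₁ z) (Ici 0) z)
    (hg₁ : HasDerivWithinAt g₁ g₂ (Ici 0) c) (h0 : 0 ≤ g₁ 0)
    (hmax : ∀ z ∈ Ico 0 d, g z ≤ g c) : g₂ ≤ 0 := by
  have hgc : 0 ≤ g₁ c := by
    rcases hc.eq_or_lt with rfl | hc'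
    · exact h0
    · exact deriv_nonneg_of_max_left hc' (fun z hz => hz.1) (hg c ⟨hc, hcd⟩)
        fun z hz => hmax z ⟨hz.1, hz.2.trans_lt hcd⟩
  -- If `g₂ > 0`, then `g₁ c ≥ 0` forces `g₁ > 0` just to the right of `c`, and `g` would exceed its
  -- maximum there. This one-sided argument also covers the wall `c = 0`.
  by_contra! hpos
  have h1 : HasDerivWithinAt g₁ g₂ (Ioi c) c :=
    hg₁.mono fun z hz => hc.trans (le_of_lt hz)
  have h2 := (hasDerivWithinAt_iff_tendsto_slope' (by simp)).1 h1
  have h3 : ∀ᶠ z in 𝓝[>] c, 0 < g₁ z := by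
    filter_upwards [h2.eventually (lt_mem_nhds hpos), self_mem_nhdsWithin] with z hz hz'
    rw [slope_def_field] at hz
    have hz'' : 0 < z - c := sub_pos.2 hz'
    have := (div_pos_iff_of_pos_right hz'').1 hz
    linarith
  obtain ⟨e, he, hsub⟩ := (mem_nhdsGT_iff_exists_Ioo_subset' hcd).1 (inter_mem h3
    (Ioo_mem_nhdsGT hcd))
  have he' : c < e := he
  have hmem : ∀ z ∈ Icc c ((c + e) / 2), z ∈ Ico 0 d := by
    intro z hz
    have hm := (hsub (⟨by linarith, by linarith⟩ : (c + e) / 2 ∈ Ioo c e)).2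
    exact ⟨hc.trans hz.1, hz.2.trans_lt hm.2⟩
  have hmono : StrictMonoOn g (Icc c ((c + e) / 2)) := by
    refine strictMonoOn_of_deriv_pos (convex_Icc _ _)
      (fun z hz => ((hg z (hmem z hz)).continuousWithinAt).mono fun r hr => hc.trans hr.1) ?_
    intro z hz
    rw [interior_Icc] at hz
    have hd := (hg z (hmem z (Ioo_subset_Icc_self hz))).hasDerivAt
      (Ici_mem_nhds (hc.trans_lt hz.1))
    rw [hd.deriv]
    exact (hsub ⟨hz.1, by linarith [hz.2]⟩).1
  have := hmono (left_mem_Icc.2 (by linarith)) (right_mem_Icc.2 (by linarith))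
    (by linarith : c < (c + e) / 2)
  linarith [hmax _ (hmem _ (right_mem_Icc.2 (by linarith : c ≤ (c + e) / 2)))]

/-- Existence of a maximum point on `[0, T] × [0, X] × [0, 1)` for a function that is
nonpositive at the edge `η = 1` and is positive somewhere. -/
lemma exists_max_of_edge {X T : ℝ} {Z : ℝ → ℝ → ℝ → ℝ} {l : ℝ → ℝ → ℝ}
    (hl : ∀ τ ≥ 0, ∀ ξ ∈ Icc 0 X, l τ ξ ≤ 0)
    (hl' : Continuous (fun p : ℝ × ℝ => l p.1 p.2))
    (hZ : ContinuousOn (unc Z) (croccoDomain X)) (hedge : HasEdgeLimit X Z l)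
    {τ₀ ξ₀ η₀ : ℝ} (hτ : τ₀ ∈ Icc 0 T) (hξ : ξ₀ ∈ Icc 0 X) (hη : η₀ ∈ Ico (0 : ℝ) 1)
    (hpos : 0 < Z τ₀ ξ₀ η₀) :
    ∃ τ ∈ Icc 0 T, ∃ ξ ∈ Icc 0 X, ∃ η ∈ Ico (0 : ℝ) 1, 0 < Z τ ξ η ∧
      ∀ τ' ∈ Icc 0 T, ∀ ξ' ∈ Icc 0 X, ∀ η' ∈ Ico (0 : ℝ) 1, Z τ' ξ' η' ≤ Z τ ξ η := by
  classical
  let K : Set (ℝ × ℝ × ℝ) := Icc 0 T ×ˢ Icc 0 X ×ˢ Icc 0 1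
  -- Filling in the edge values `l` gives a continuous function on a compact box. Since `l ≤ 0`, its
  -- positive maximum cannot lie on the edge.
  let F : ℝ × ℝ × ℝ → ℝ := fun p => if p.2.2 < 1 then unc Z p else l p.1 p.2.1
  have hK : IsCompact K := isCompact_Icc.prod (isCompact_Icc.prod isCompact_Icc)
  have hsub : ∀ p ∈ K, p.2.2 < 1 → p ∈ croccoDomain X := fun p hp h1 =>
    ⟨hp.1.1, hp.2.1, hp.2.2.1, h1⟩
  have hFc : ContinuousOn F K := by
    rintro ⟨τ, ξ, η⟩ hp
    rcases hp.2.2.2.lt_or_eq with h1 | h1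
    · have hev : ∀ᶠ q in 𝓝[K] (τ, ξ, η), q.2.2 < 1 :=
        nhdsWithin_le_nhds ((continuous_snd.snd.continuousAt).eventually (gt_mem_nhds h1))
      have hc := hZ _ (hsub _ hp h1)
      have hc' : ContinuousWithinAt (unc Z) K (τ, ξ, η) :=
        hc.mono_of_mem_nhdsWithin (by
          filter_upwards [hev, self_mem_nhdsWithin] with q hq hqK using hsub q hqK hq)
      refine hc'.congr_of_eventuallyEq ?_ (by simp only [F]; rw [if_pos h1])
      filter_upwards [hev] with q hq
      simp only [F]; rw [if_pos hq]
    · simp only at h1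
      subst h1
      have hF : F (τ, ξ, 1) = l τ ξ := by simp [F]
      rw [ContinuousWithinAt, hF]
      have hA := hedge τ hp.1.1 ξ hp.2.1
      have hB : Tendsto (fun p : ℝ × ℝ × ℝ => l p.1 p.2.1) (𝓝 (τ, ξ, 1)) (𝓝 (l τ ξ)) :=
        ((hl'.comp (continuous_fst.prodMk continuous_snd.fst)).continuousAt)
      refine Tendsto.if (p := fun p : ℝ × ℝ × ℝ => p.2.2 < 1) (hA.mono_left ?_)
        (hB.mono_left (inf_le_left.trans nhdsWithin_le_nhds))
      rw [nhdsWithin, inf_assoc, inf_principal]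
      exact inf_le_inf_left _ (principal_mono.2 fun q hq => hsub q hq.1 hq.2)
  have hp₀ : (τ₀, ξ₀, η₀) ∈ K := ⟨hτ, hξ, hη.1, hη.2.le⟩
  obtain ⟨⟨τ, ξ, η⟩, hp, hmax⟩ := hK.exists_isMaxOn ⟨_, hp₀⟩ hFc
  have hF : ∀ τ' ξ' η', η' < 1 → F (τ', ξ', η') = Z τ' ξ' η' := fun τ' ξ' η' h => by
    simp [F, h, unc]
  have h0 : 0 < F (τ, ξ, η) := by
    have h := hmax hp₀
    simp only [mem_ofPred_eq, hF _ _ _ hη.2] at h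
    linarith
  have hη1 : η < 1 := by
    by_contra hcon
    have : F (τ, ξ, η) = l τ ξ := by simp [F, hcon]
    linarith [hl τ hp.1.1 ξ hp.2.1]
  refine ⟨τ, hp.1, ξ, hp.2.1, η, ⟨hp.2.2.1, hη1⟩, by rwa [hF _ _ _ hη1] at h0, ?_⟩
  intro τ' hτ' ξ' hξ' η' hη'
  have h := hmax (show (τ', ξ', η') ∈ K from ⟨hτ', hξ', hη'.1, hη'.2.le⟩)
  simpa only [mem_ofPred_eq, hF _ _ _ hη'.2, hF _ _ _ hη1] using h

/-- Maximum principle for the degenerate parabolic operator `-∂_τ - η ∂_ξ + a ∂_η²` with the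
oblique condition `∂_η W ≥ 0` at `η = 0`. The differential inequality is only needed where
`W > 0`. -/
theorem max_principle {X : ℝ} {W Wy : ℝ → ℝ → ℝ → ℝ} {l : ℝ → ℝ → ℝ}
    (hl : ∀ τ ≥ 0, ∀ ξ ∈ Icc 0 X, l τ ξ ≤ 0)
    (hl' : Continuous (fun p : ℝ × ℝ => l p.1 p.2))
    (hW : ContinuousOn (unc W) (croccoDomain X)) (hedge : HasEdgeLimit X W l)
    (hinit : ∀ ξ ∈ Icc 0 X, ∀ η ∈ Ico (0 : ℝ) 1, W 0 ξ η ≤ 0)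
    (hin : ∀ τ ≥ 0, ∀ η ∈ Ico (0 : ℝ) 1, W τ 0 η ≤ 0)
    (hWy : ∀ τ > 0, ∀ ξ ∈ Ioc 0 X, ∀ η ∈ Ico (0 : ℝ) 1,
      HasDerivWithinAt (W τ ξ) (Wy τ ξ η) (Ici 0) η)
    (hwall : ∀ τ > 0, ∀ ξ ∈ Ioc 0 X, 0 ≤ Wy τ ξ 0)
    (hpde : ∀ τ > 0, ∀ ξ ∈ Ioc 0 X, ∀ η ∈ Ico (0 : ℝ) 1, 0 < W τ ξ η →
      ∃ a wt wx wyy : ℝ, 0 ≤ a ∧ HasDerivWithinAt (fun s => W s ξ η) wt (Ici 0) τ ∧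
        HasDerivWithinAt (fun s => W τ s η) wx (Icc 0 X) ξ ∧
        HasDerivWithinAt (Wy τ ξ) wyy (Ici 0) η ∧ wt + η * wx ≤ a * wyy) :
    ∀ τ ≥ 0, ∀ ξ ∈ Icc 0 X, ∀ η ∈ Ico (0 : ℝ) 1, W τ ξ η ≤ 0 := by
  intro T hT ξ₀ hξ₀ η₀ hη₀
  by_contra! hpos
  -- Subtracting `ε τ` makes the `τ`-derivative of `W` at the maximum at least `ε`, so the
  -- non-strict differential inequality suffices for a contradiction. The maximum may sit at `τ = T`
  -- or `ξ = X`, where left derivatives are enough.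
  obtain ⟨ε, hε, hεT⟩ : ∃ ε > 0, ε * T < W T ξ₀ η₀ := by
    refine ⟨W T ξ₀ η₀ / (T + 1), by positivity, ?_⟩
    rw [div_mul_eq_mul_div, div_lt_iff₀ (by linarith)]
    nlinarith
  obtain ⟨τ, hτ, ξ, hξ, η, hη, hZ, hmax⟩ :=
    exists_max_of_edge (X := X) (T := T) (Z := fun τ ξ η => W τ ξ η - ε * τ)
      (l := fun τ ξ => l τ ξ - ε * τ)
      (fun τ hτ ξ hξ => by linarith [mul_nonneg hε.le hτ, hl τ hτ ξ hξ])
      (hl'.sub (by fun_prop))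
      (hW.sub (by fun_prop))
      (fun τ hτ ξ hξ => (hedge τ hτ ξ hξ).sub
        (tendsto_nhdsWithin_of_tendsto_nhds
          ((by fun_prop : Continuous fun p : ℝ × ℝ × ℝ => ε * p.1).tendsto (τ, ξ, 1))))
      ⟨hT, le_rfl⟩ hξ₀ hη₀ (by simpa using hεT)
  have hτn := mul_nonneg hε.le hτ.1
  have hWpos : 0 < W τ ξ η := by linarith
  have hτ0 : 0 < τ := hτ.1.lt_of_ne fun h => by
    have := hinit ξ hξ η hη
    rw [h] at this; linarith
  have hξ0 : 0 < ξ := hξ.1.lt_of_ne fun h => by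
    have := hin τ hτ.1 η hη
    rw [h] at this; linarith
  have hξ' : ξ ∈ Ioc 0 X := ⟨hξ0, hξ.2⟩
  obtain ⟨a, wt, wx, wyy, ha, ht, hx, hyy, hle⟩ := hpde τ hτ0 ξ hξ' η hη hWpos
  have h1 : 0 ≤ wt - ε * 1 :=
    deriv_nonneg_of_max_left (g := fun s => W s ξ η - ε * s) hτ0 (fun z hz => hz.1)
      (ht.sub ((hasDerivWithinAt_id τ _).const_mul ε))
      fun z hz => hmax z ⟨hz.1, hz.2.trans hτ.2⟩ ξ hξ η hη
  have h2 : 0 ≤ wx :=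
    deriv_nonneg_of_max_left (g := fun s => W τ s η) (s := Icc 0 X) hξ0
      (fun z hz => ⟨hz.1, hz.2.trans hξ.2⟩) hx
      fun z hz => by linarith [hmax τ hτ z ⟨hz.1, hz.2.trans hξ.2⟩ η hη]
  have h3 : wyy ≤ 0 :=
    snd_deriv_nonpos_of_max hη.1 hη.2 (hWy τ hτ0 ξ hξ') hyy (hwall τ hτ0 ξ hξ')
      fun z hz => by linarith [hmax τ hτ ξ hξ z hz]
  nlinarith [mul_nonneg hη.1 h2, mul_nonneg ha (neg_nonneg.2 h3)]

/-! ### Elementary properties of the profiles `u` and `w` -/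

namespace IsOleinikSolution

variable {X : ℝ} {u w : ℝ → ℝ → ℝ → ℝ} {t x y η : ℝ}

lemma contDiffOn_u (h : IsOleinikSolution X u w) : ContDiffOn ℝ (2 : ℕ) (unc u) (box X (Ici 0)) :=
  h.prandtl.choose_spec.contDiffOn_u

lemma differentiableOn_u (h : IsOleinikSolution X u w) :
    DifferentiableOn ℝ (unc u) (box X (Ici 0)) :=
  h.contDiffOn_u.differentiableOn (by norm_num)

lemma contDiffOn_w (h : IsOleinikSolution X u w) :
    ContDiffOn ℝ (2 : ℕ) (unc w) (box X (Ico 0 1)) := h.contDiffOn_two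

lemma differentiableOn_w (h : IsOleinikSolution X u w) :
    DifferentiableOn ℝ (unc w) (box X (Ico 0 1)) :=
  h.contDiffOn_w.differentiableOn (by norm_num)

lemma u_wall (h : IsOleinikSolution X u w) (ht : 0 ≤ t) (hx : x ∈ Icc 0 X) : u t x 0 = 0 :=
  h.prandtl.choose_spec.u_wall t ht x hx

lemma u_far (h : IsOleinikSolution X u w) (ht : 0 ≤ t) (hx : x ∈ Icc 0 X) :
    Tendsto (u t x) atTop (𝓝 1) :=
  h.prandtl.choose_spec.u_far t ht x hx

lemma hasDerivWithinAt_u (h : IsOleinikSolution X u w) (ht : 0 ≤ t) (hx : x ∈ Icc 0 X)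
    (hy : 0 ≤ y) : HasDerivWithinAt (u t x) (dY u t x y) (Ici 0) y :=
  hasDerivWithinAt_dY relOpen_Ici h.differentiableOn_u ht hx hy

lemma continuousOn_slice_u (h : IsOleinikSolution X u w) (ht : 0 ≤ t) (hx : x ∈ Icc 0 X) :
    ContinuousOn (u t x) (Ici 0) :=
  fun _ hy => (h.hasDerivWithinAt_u ht hx hy).continuousWithinAt

lemma strictMonoOn_u (h : IsOleinikSolution X u w) (ht : 0 ≤ t) (hx : x ∈ Icc 0 X) :
    StrictMonoOn (u t x) (Ici 0) := by
  refine strictMonoOn_of_deriv_pos (convex_Ici 0) (h.continuousOn_slice_u ht hx) fun z hz => ?_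
  rw [interior_Ici] at hz
  rw [((h.hasDerivWithinAt_u ht hx (le_of_lt hz)).hasDerivAt (Ici_mem_nhds hz)).deriv]
  exact h.monotone t ht x hx z (le_of_lt hz)

lemma u_mem (h : IsOleinikSolution X u w) (ht : 0 ≤ t) (hx : x ∈ Icc 0 X) (hy : 0 ≤ y) :
    u t x y ∈ Ico (0 : ℝ) 1 := by
  have hm := h.strictMonoOn_u ht hx
  refine ⟨?_, ?_⟩
  · rw [← h.u_wall ht hx]
    exact hm.monotoneOn self_mem_Ici hy hy
  · have h1 : u t x y < u t x (y + 1) := hm hy (by simp; linarith) (by linarith)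
    refine h1.trans_le (ge_of_tendsto (h.u_far ht hx) ?_)
    filter_upwards [eventually_ge_atTop (y + 1)] with z hz
    exact hm.monotoneOn (by simp; linarith) (by simp; linarith) hz

lemma exists_u_eq (h : IsOleinikSolution X u w) (ht : 0 ≤ t) (hx : x ∈ Icc 0 X)
    (hη : η ∈ Ico (0 : ℝ) 1) : ∃ y ≥ 0, u t x y = η := by
  obtain ⟨z, hz, hz0⟩ := (((h.u_far ht hx).eventually (lt_mem_nhds hη.2)).and
    (eventually_ge_atTop 0)).exists
  obtain ⟨y, hy, hyη⟩ := intermediate_value_Icc hz0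
    ((h.continuousOn_slice_u ht hx).mono Icc_subset_Ici_self)
    (show η ∈ Icc (u t x 0) (u t x z) from ⟨by rw [h.u_wall ht hx]; exact hη.1, hz.le⟩)
  exact ⟨y, hy.1, hyη⟩

lemma w_pos (h : IsOleinikSolution X u w) (ht : 0 ≤ t) (hx : x ∈ Icc 0 X)
    (hη : η ∈ Ico (0 : ℝ) 1) : 0 < w t x η := by
  obtain ⟨y, hy, rfl⟩ := h.exists_u_eq ht hx hη
  rw [h.crocco t ht x hx y hy]
  exact h.monotone t ht x hx y hy

lemma hasDerivWithinAt_w (h : IsOleinikSolution X u w) (ht : 0 ≤ t) (hx : x ∈ Icc 0 X)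
    (hη : η ∈ Ico (0 : ℝ) 1) : HasDerivWithinAt (w t x) (dY w t x η) (Ici 0) η :=
  hasDerivWithinAt_dY relOpen_Ico h.differentiableOn_w ht hx hη

lemma contDiffOn_dY_w (hX : 0 < X) (h : IsOleinikSolution X u w) :
    ContDiffOn ℝ (1 : ℕ) (unc (dY w)) (box X (Ico 0 1)) :=
  contDiffOn_dY hX relOpen_Ico h.contDiffOn_w

lemma hasDerivWithinAt_dY_w (hX : 0 < X) (h : IsOleinikSolution X u w) (ht : 0 ≤ t)
    (hx : x ∈ Icc 0 X) (hη : η ∈ Ico (0 : ℝ) 1) :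
    HasDerivWithinAt (dY w t x) (dYY w t x η) (Ici 0) η :=
  hasDerivWithinAt_dY relOpen_Ico ((h.contDiffOn_dY_w hX).differentiableOn (by norm_num)) ht hx hη

lemma continuousOn_dYY_w (hX : 0 < X) (h : IsOleinikSolution X u w) :
    ContinuousOn (unc (dYY w)) (box X (Ico 0 1)) :=
  (contDiffOn_dY (n := 0) hX relOpen_Ico (h.contDiffOn_dY_w hX)).continuousOn

end IsOleinikSolution

/-! ### The Crocco equation and its wall condition -/

lemma hasDerivAt_slice_trd (t x y : ℝ) :
    HasDerivAt (fun s : ℝ => ((t, x, s) : ℝ × ℝ × ℝ)) (0, 0, 1) y :=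
  (hasDerivAt_const y t).prodMk ((hasDerivAt_const y x).prodMk (hasDerivAt_id y))

/-- Pointwise derivation of the Crocco equation from the Prandtl equation. -/
lemma crocco_pde_of_momentum {f g : ℝ × ℝ × ℝ → ℝ} {v : ℝ → ℝ} {t x y : ℝ}
    (hf : ContDiffAt ℝ 2 f (t, x, y)) (hg : ContDiffAt ℝ 2 g (t, x, f (t, x, y)))
    (hcr : ∀ᶠ p in 𝓝 (t, x, y), g (p.1, p.2.1, f p) = fderiv ℝ f p (0, 0, 1))
    (hv : HasDerivAt v (-fderiv ℝ f (t, x, y) (0, 1, 0)) y)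
    (hmom : ∀ᶠ s in 𝓝 y, fderiv ℝ f (t, x, s) (1, 0, 0)
      + f (t, x, s) * fderiv ℝ f (t, x, s) (0, 1, 0) + v s * fderiv ℝ f (t, x, s) (0, 0, 1)
      - fderiv ℝ (fun p => fderiv ℝ f p (0, 0, 1)) (t, x, s) (0, 0, 1) = 0) :
    fderiv ℝ g (t, x, f (t, x, y)) (1, 0, 0)
      + f (t, x, y) * fderiv ℝ g (t, x, f (t, x, y)) (0, 1, 0)
      = g (t, x, f (t, x, y)) ^ 2
        * fderiv ℝ (fun q => fderiv ℝ g q (0, 0, 1)) (t, x, f (t, x, y)) (0, 0, 1) := by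
  set p₀ : ℝ × ℝ × ℝ := (t, x, y) with hp₀
  set q₀ : ℝ × ℝ × ℝ := (t, x, f p₀) with hq₀
  let Q : ℝ × ℝ × ℝ → ℝ × ℝ × ℝ := fun p => (p.1, p.2.1, f p)
  have hfd : ∀ᶠ p in 𝓝 p₀, DifferentiableAt ℝ f p := by
    filter_upwards [hf.eventually (by simp)] with p hp using hp.differentiableAt (by norm_num)
  have hQd : ∀ p, DifferentiableAt ℝ f p →
      HasFDerivAt Q ((ContinuousLinearMap.fst ℝ ℝ (ℝ × ℝ)).prod
        (((ContinuousLinearMap.fst ℝ ℝ ℝ).comp (ContinuousLinearMap.snd ℝ ℝ (ℝ × ℝ))).prod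
          (fderiv ℝ f p))) p := fun p hp =>
    hasFDerivAt_fst.prodMk ((hasFDerivAt_fst.comp p hasFDerivAt_snd).prodMk hp.hasFDerivAt)
  have hQc : ContinuousAt Q p₀ := (hQd p₀ hfd.self_of_nhds).continuousAt
  have hgd : ∀ᶠ p in 𝓝 p₀, DifferentiableAt ℝ g (Q p) := by
    refine hQc.eventually (p := fun q => DifferentiableAt ℝ g q) ?_
    filter_upwards [hg.eventually (by simp)] with q hq using hq.differentiableAt (by norm_num)
  -- first derivatives of `∂_y f = g ∘ Q`
  have hG : ∀ᶠ p in 𝓝 p₀, ∀ e : ℝ × ℝ × ℝ,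
      fderiv ℝ (fun p => fderiv ℝ f p (0, 0, 1)) p e
        = fderiv ℝ g (Q p) (e.1, e.2.1, fderiv ℝ f p e) := by
    filter_upwards [hfd, hgd, hcr.eventually_nhds] with p h1 h2 h3 e
    have h4 : (fun p => fderiv ℝ f p (0, 0, 1)) =ᶠ[𝓝 p] g ∘ Q := by
      filter_upwards [h3] with z hz using hz.symm
    rw [h4.fderiv_eq, (h2.hasFDerivAt.comp p (hQd p h1)).fderiv]
    rfl
  have hlin : ∀ q a c d, fderiv ℝ g q (a, c, d) = a * fderiv ℝ g q (1, 0, 0)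
      + c * fderiv ℝ g q (0, 1, 0) + d * fderiv ℝ g q (0, 0, 1) := by
    intro q a c d
    have : ((a, c, d) : ℝ × ℝ × ℝ) = a • (1, 0, 0) + c • (0, 1, 0) + d • (0, 0, 1) := by simp
    rw [this]; simp only [map_add, map_smul, smul_eq_mul]
  -- symmetry of second derivatives
  have hsymm := hf.isSymmSndFDerivAt (by simp)
  have hf1 : DifferentiableAt ℝ (fderiv ℝ f) p₀ :=
    (hf.fderiv_right (m := 1) (by norm_num)).differentiableAt (by norm_num)
  have hev : ∀ e e' : ℝ × ℝ × ℝ,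
      fderiv ℝ (fun p => fderiv ℝ f p e) p₀ e' = fderiv ℝ (fderiv ℝ f) p₀ e' e := by
    intro e e'
    rw [(hf1.hasFDerivAt.clm_apply (hasFDerivAt_const e p₀)).fderiv]
    simp
  have hslice := hasDerivAt_slice_trd t x y
  -- By symmetry, `∂_y ∂_e f = ∂_e ∂_y f`, and the latter is computed by the chain rule from `∂_y f
  -- = g ∘ Q`.
  have hdir : ∀ e : ℝ × ℝ × ℝ, HasDerivAt (fun s => fderiv ℝ f (t, x, s) e)
      (fderiv ℝ g q₀ (e.1, e.2.1, fderiv ℝ f p₀ e)) y := by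
    intro e
    have h1 : HasFDerivAt (fun p => fderiv ℝ f p e) (fderiv ℝ (fun p => fderiv ℝ f p e) p₀) p₀ :=
      ((hf1.hasFDerivAt.clm_apply (hasFDerivAt_const e p₀)).differentiableAt).hasFDerivAt
    have h2 := h1.comp_hasDerivAt y hslice
    rw [hev, hsymm.eq, ← hev, hG.self_of_nhds] at h2
    exact h2
  have hu : HasDerivAt (fun s => f (t, x, s)) (fderiv ℝ f p₀ (0, 0, 1)) y :=
    hfd.self_of_nhds.hasFDerivAt.comp_hasDerivAt y hslice
  -- both sides of `∂_y² f = ∂_t f + f ∂_x f + v ∂_y f`, differentiated in `y`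
  have hA := ((hdir (1, 0, 0)).add (hu.mul (hdir (0, 1, 0)))).add (hv.mul (hdir (0, 0, 1)))
  have hlinev : ∀ᶠ s in 𝓝 y, ∀ e : ℝ × ℝ × ℝ,
      fderiv ℝ (fun p => fderiv ℝ f p (0, 0, 1)) (t, x, s) e
        = fderiv ℝ g (Q (t, x, s)) (e.1, e.2.1, fderiv ℝ f (t, x, s) e) :=
    hslice.continuousAt.eventually hG
  have hcrs : ∀ᶠ s in 𝓝 y, g (Q (t, x, s)) = fderiv ℝ f (t, x, s) (0, 0, 1) :=
    hslice.continuousAt.eventually hcr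
  have hg1 : DifferentiableAt ℝ (fun q => fderiv ℝ g q (0, 0, 1)) q₀ :=
    (((hg.fderiv_right (m := 1) (by norm_num)).differentiableAt (by norm_num)).clm_apply
      (differentiableAt_const _))
  have hq : HasDerivAt (fun s => Q (t, x, s)) (0, 0, fderiv ℝ f p₀ (0, 0, 1)) y :=
    (hasDerivAt_const y t).prodMk ((hasDerivAt_const y x).prodMk hu)
  have hgy : HasDerivAt (fun s => fderiv ℝ g (Q (t, x, s)) (0, 0, 1))
      (fderiv ℝ (fun q => fderiv ℝ g q (0, 0, 1)) q₀ (0, 0, fderiv ℝ f p₀ (0, 0, 1))) y :=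
    HasFDerivAt.comp_hasDerivAt (f := fun s => Q (t, x, s)) y hg1.hasFDerivAt hq
  have hB := (hdir (0, 0, 1)).mul hgy
  -- Writing `∂_y² f` as `∂_y f · (∂_η g ∘ Q)` lets the momentum equation be differentiated in `y`
  -- without a third derivative of `f`, which is only `C²`. The terms in `∂_x f · ∂_y f` cancel by
  -- incompressibility, and those in `∂_η g` by the momentum equation itself.
  have heq : (fun s => fderiv ℝ f (t, x, s) (0, 0, 1) * fderiv ℝ g (Q (t, x, s)) (0, 0, 1))
      =ᶠ[𝓝 y] fun s => fderiv ℝ f (t, x, s) (1, 0, 0)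
      + f (t, x, s) * fderiv ℝ f (t, x, s) (0, 1, 0) + v s * fderiv ℝ f (t, x, s) (0, 0, 1) := by
    filter_upwards [hlinev, hmom] with s h1 h2
    rw [h1, hlin] at h2
    simp only at h2
    linarith
  have hval := heq.self_of_nhds
  have huniq := (hA.congr_of_eventuallyEq heq).unique hB
  have hc0 : g q₀ = fderiv ℝ f p₀ (0, 0, 1) := hcr.self_of_nhds
  have hsm : ∀ d : ℝ, fderiv ℝ (fun q => fderiv ℝ g q (0, 0, 1)) q₀ (0, 0, d)
      = d * fderiv ℝ (fun q => fderiv ℝ g q (0, 0, 1)) q₀ (0, 0, 1) := by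
    intro d
    have : ((0, 0, d) : ℝ × ℝ × ℝ) = d • (0, 0, 1) := by simp
    rw [this, map_smul, smul_eq_mul]
  dsimp only at huniq
  rw [hsm (fderiv ℝ f p₀ (0, 0, 1)), hlin q₀ 1 0 (fderiv ℝ f p₀ (1, 0, 0)),
    hlin q₀ 0 1 (fderiv ℝ f p₀ (0, 1, 0)), hlin q₀ 0 0 (fderiv ℝ f p₀ (0, 0, 1))] at huniq
  change fderiv ℝ f p₀ (0, 0, 1) * fderiv ℝ g q₀ (0, 0, 1) = fderiv ℝ f p₀ (1, 0, 0)
      + f p₀ * fderiv ℝ f p₀ (0, 1, 0) + v y * fderiv ℝ f p₀ (0, 0, 1) at hval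
  rw [hc0]
  change _ = _ * fderiv ℝ g q₀ (0, 0, 1) + _ at huniq
  linear_combination huniq + fderiv ℝ g q₀ (0, 0, 1) * hval

section Interior

variable {X : ℝ} {S : Set ℝ} {f : ℝ → ℝ → ℝ → ℝ} {t x y : ℝ}

lemma box_mem_nhds (ht : 0 < t) (hx : x ∈ Ioo 0 X) (hy : S ∈ 𝓝 y) : box X S ∈ 𝓝 (t, x, y) :=
  prod_mem_nhds (Ici_mem_nhds ht) (prod_mem_nhds (Icc_mem_nhds hx.1 hx.2) hy)

lemma dT_eq_fderiv (hf : DifferentiableOn ℝ (unc f) (box X S)) (ht : 0 < t) (hx : x ∈ Ioo 0 X)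
    (hy : S ∈ 𝓝 y) : dT f t x y = fderiv ℝ (unc f) (t, x, y) (1, 0, 0) := by
  rw [dT_eq hf ht.le (Ioo_subset_Icc_self hx) (mem_of_mem_nhds hy),
    fderivWithin_of_mem_nhds (box_mem_nhds ht hx hy)]

lemma dX_eq_fderiv (hX : 0 < X) (hf : DifferentiableOn ℝ (unc f) (box X S)) (ht : 0 < t)
    (hx : x ∈ Ioo 0 X) (hy : S ∈ 𝓝 y) :
    dX X f t x y = fderiv ℝ (unc f) (t, x, y) (0, 1, 0) := by
  rw [dX_eq hX hf ht.le (Ioo_subset_Icc_self hx) (mem_of_mem_nhds hy),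
    fderivWithin_of_mem_nhds (box_mem_nhds ht hx hy)]

lemma dY_eq_fderiv (hS : RelOpen S) (hf : DifferentiableOn ℝ (unc f) (box X S)) (ht : 0 < t)
    (hx : x ∈ Ioo 0 X) (hy : S ∈ 𝓝 y) :
    dY f t x y = fderiv ℝ (unc f) (t, x, y) (0, 0, 1) := by
  rw [dY_eq hS hf ht.le (Ioo_subset_Icc_self hx) (mem_of_mem_nhds hy),
    fderivWithin_of_mem_nhds (box_mem_nhds ht hx hy)]

lemma eventually_interior (ht : 0 < t) (hx : x ∈ Ioo 0 X) (hy : S ∈ 𝓝 y) :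
    ∀ᶠ p : ℝ × ℝ × ℝ in 𝓝 (t, x, y), 0 < p.1 ∧ p.2.1 ∈ Ioo 0 X ∧ S ∈ 𝓝 p.2.2 := by
  have h1 : ∀ᶠ p : ℝ × ℝ × ℝ in 𝓝 (t, x, y), 0 < p.1 :=
    continuous_fst.continuousAt.eventually (lt_mem_nhds ht)
  have h2 : ∀ᶠ p : ℝ × ℝ × ℝ in 𝓝 (t, x, y), p.2.1 ∈ Ioo 0 X :=
    continuous_snd.fst.continuousAt.eventually (Ioo_mem_nhds hx.1 hx.2)
  have h3 : ∀ᶠ p : ℝ × ℝ × ℝ in 𝓝 (t, x, y), S ∈ 𝓝 p.2.2 :=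
    continuous_snd.snd.continuousAt.eventually (eventually_mem_nhds_iff.2 hy)
  filter_upwards [h1, h2, h3] with p a b c using ⟨a, b, c⟩

lemma dYY_eq_fderiv (hX : 0 < X) (hS : RelOpen S) (hf : ContDiffOn ℝ (2 : ℕ) (unc f) (box X S))
    (ht : 0 < t) (hx : x ∈ Ioo 0 X) (hy : S ∈ 𝓝 y) :
    dYY f t x y = fderiv ℝ (fun p => fderiv ℝ (unc f) p (0, 0, 1)) (t, x, y) (0, 0, 1) := by
  have h1 := (contDiffOn_dY (n := 1) hX hS hf).differentiableOn (by norm_num)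
  rw [dYY, dY_eq_fderiv hS h1 ht hx hy]
  congr 1
  refine Filter.EventuallyEq.fderiv_eq ?_
  filter_upwards [eventually_interior ht hx hy] with p hp
  exact dY_eq_fderiv hS (hf.differentiableOn (by norm_num)) hp.1 hp.2.1 hp.2.2

end Interior

namespace IsOleinikSolution

variable {X : ℝ} {u w : ℝ → ℝ → ℝ → ℝ} {t x y η : ℝ}

/-- The point `x = X` is excluded so that the box is a neighbourhood and ordinary Fréchet
derivatives are available. The boundary is reached afterwards by density. -/
lemma crocco_equation_interior (hX : 0 < X) (h : IsOleinikSolution X u w) (ht : 0 < t)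
    (hx : x ∈ Ioo 0 X) (hη : η ∈ Ioo (0 : ℝ) 1) :
    dT w t x η + η * dX X w t x η = w t x η ^ 2 * dYY w t x η := by
  have hx' := Ioo_subset_Icc_self hx
  obtain ⟨y, hy, rfl⟩ := h.exists_u_eq ht.le hx' (Ioo_subset_Ico_self hη)
  have hy0 : 0 < y := hy.lt_of_ne fun h0 => by
    have := hη.1
    rw [← h0, h.u_wall ht.le hx'] at this
    exact this.false
  obtain ⟨v, hv⟩ := h.prandtl
  have hyn : Ici (0 : ℝ) ∈ 𝓝 y := Ici_mem_nhds hy0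
  have hηn : Ico (0 : ℝ) 1 ∈ 𝓝 (u t x y) := Ico_mem_nhds hη.1 hη.2
  rw [dT_eq_fderiv h.differentiableOn_w ht hx hηn, dX_eq_fderiv hX h.differentiableOn_w ht hx hηn,
    dYY_eq_fderiv hX relOpen_Ico h.contDiffOn_w ht hx hηn]
  refine crocco_pde_of_momentum (f := unc u) (g := unc w) (v := v t x) (t := t) (x := x) (y := y)
    (h.contDiffOn_u.contDiffAt (box_mem_nhds ht hx hyn))
    (h.contDiffOn_w.contDiffAt (box_mem_nhds ht hx hηn)) ?_ ?_ ?_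
  · filter_upwards [eventually_interior ht hx hyn] with p hp
    have hp2 : p.2.2 ∈ Ici (0 : ℝ) := mem_of_mem_nhds hp.2.2
    rw [← dY_eq_fderiv relOpen_Ici h.differentiableOn_u hp.1 hp.2.1 hp.2.2]
    exact h.crocco _ hp.1.le _ (Ioo_subset_Icc_self hp.2.1) _ hp2
  · rw [← dX_eq_fderiv hX h.differentiableOn_u ht hx hyn]
    exact hv.divergence t ht x (Ioo_subset_Ioc_self hx) y hy0
  · filter_upwards [lt_mem_nhds hy0] with s hs
    have hsn : Ici (0 : ℝ) ∈ 𝓝 s := Ici_mem_nhds hs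
    rw [← dT_eq_fderiv h.differentiableOn_u ht hx hsn,
      ← dX_eq_fderiv hX h.differentiableOn_u ht hx hsn,
      ← dY_eq_fderiv relOpen_Ici h.differentiableOn_u ht hx hsn,
      ← dYY_eq_fderiv hX relOpen_Ici h.contDiffOn_u ht hx hsn]
    exact hv.momentum t ht x (Ioo_subset_Ioc_self hx) s hs

/-- The Crocco equation, on the whole Crocco domain. -/
theorem crocco_equation (hX : 0 < X) (h : IsOleinikSolution X u w) (ht : 0 ≤ t)
    (hx : x ∈ Icc 0 X) (hη : η ∈ Ico (0 : ℝ) 1) :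
    dT w t x η + η * dX X w t x η = w t x η ^ 2 * dYY w t x η := by
  have hT := (contDiffOn_dT (n := 1) hX relOpen_Ico h.contDiffOn_w).continuousOn
  have hXc := (contDiffOn_dX (n := 1) hX relOpen_Ico h.contDiffOn_w).continuousOn
  have hYY := h.continuousOn_dYY_w hX
  have hw := h.contDiffOn_w.continuousOn
  have hEq : EqOn (fun p => unc (dT w) p + p.2.2 * unc (dX X w) p)
      (fun p => unc w p ^ 2 * unc (dYY w) p) (box X (Ico 0 1)) := by
    refine EqOn.of_subset_closure (s := Ioi 0 ×ˢ Ioo 0 X ×ˢ Ioo 0 1)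
      (fun p hp => h.crocco_equation_interior hX hp.1 hp.2.1 hp.2.2)
      (hT.add (continuous_snd.snd.continuousOn.mul hXc)) ((hw.pow 2).mul hYY)
      (prod_mono Ioi_subset_Ici_self (prod_mono Ioo_subset_Icc_self Ioo_subset_Ico_self)) ?_
    rw [closure_prod_eq, closure_prod_eq, closure_Ioi, closure_Ioo hX.ne, closure_Ioo (by norm_num)]
    exact prod_mono subset_rfl (prod_mono subset_rfl Ico_subset_Icc_self)
  exact hEq (show (t, x, η) ∈ box X (Ico 0 1) from ⟨ht, hx, hη⟩)

lemma hasDerivWithinAt_dY_u (h : IsOleinikSolution X u w) (ht : 0 ≤ t)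
    (hx : x ∈ Icc 0 X) (hy : 0 ≤ y) :
    HasDerivWithinAt (dY u t x) (dY w t x (u t x y) * dY u t x y) (Ici 0) y := by
  have h1 := h.hasDerivWithinAt_u ht hx hy
  have h2 := h.hasDerivWithinAt_w ht hx (h.u_mem ht hx hy)
  have h3 := h2.comp y h1 fun z hz => (h.u_mem ht hx hz).1
  exact h3.congr (fun z hz => (h.crocco t ht x hx z hz).symm) (h.crocco t ht x hx y hy).symm

lemma continuousOn_slice {g : ℝ → ℝ → ℝ → ℝ} {S : Set ℝ} (hg : ContinuousOn (unc g) (box X S))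
    (ht : 0 ≤ t) (hx : x ∈ Icc 0 X) : ContinuousOn (g t x) S :=
  hg.comp (f := fun s => (t, x, s)) (by fun_prop) fun _ hs => ⟨ht, hx, hs⟩

/-- Letting `y → 0` in the momentum equation leaves `∂_y² u = 0` at the wall. There `∂_y² u = ∂_η w
· ∂_y u` with `∂_y u > 0`. -/
lemma dY_w_wall_interior (hX : 0 < X) (h : IsOleinikSolution X u w) (ht : 0 < t)
    (hx : x ∈ Ioc 0 X) : dY w t x 0 = 0 := by
  have hx' := Ioc_subset_Icc_self hx
  obtain ⟨v, hv⟩ := h.prandtl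
  have hT := continuousOn_slice
    (contDiffOn_dT (n := 1) hX relOpen_Ici h.contDiffOn_u).continuousOn ht.le hx'
  have hXc := continuousOn_slice
    (contDiffOn_dX (n := 1) hX relOpen_Ici h.contDiffOn_u).continuousOn ht.le hx'
  have hYd := contDiffOn_dY (n := 1) hX relOpen_Ici h.contDiffOn_u
  have hY := continuousOn_slice hYd.continuousOn ht.le hx'
  have hYY := continuousOn_slice (contDiffOn_dY (n := 0) hX relOpen_Ici hYd).continuousOn ht.le hx'
  have hu := h.continuousOn_slice_u ht.le hx'
  have hvc := hv.continuousOn_v t ht x hx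
  have hEq : EqOn (fun y => dT u t x y + u t x y * dX X u t x y + v t x y * dY u t x y
      - dYY u t x y) (fun _ => 0) (Ici 0) := by
    refine EqOn.of_subset_closure (s := Ioi 0) (fun y hy => hv.momentum t ht x hx y hy)
      (((hT.add (hu.mul hXc)).add (hvc.mul hY)).sub hYY) continuousOn_const Ioi_subset_Ici_self ?_
    rw [closure_Ioi]
  have h0 := hEq (self_mem_Ici : (0 : ℝ) ∈ Ici 0)
  have hT0 : dT u t x 0 = 0 := by
    have he : EqOn (fun s => u s x 0) (fun _ => 0) (Ici 0) := fun s hs => h.u_wall hs hx'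
    rw [dT, derivWithin_congr he (he ht.le)]
    simp
  have hYY0 : dYY u t x 0 = dY w t x 0 * dY u t x 0 := by
    have := (h.hasDerivWithinAt_dY_u ht.le hx' le_rfl).derivWithin
      (uniqueDiffOn_Ici 0 _ self_mem_Ici)
    rw [h.u_wall ht.le hx'] at this
    exact this
  simp only [hT0, h.u_wall ht.le hx', hv.v_wall t ht x hx, hYY0] at h0
  have hpos := h.monotone t ht.le x hx' 0 le_rfl
  have : dY w t x 0 * dY u t x 0 = 0 := by linarith
  exact (mul_eq_zero.1 this).resolve_right (ne_of_gt hpos)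

/-- The boundary condition `∂_η w = 0` at the wall. -/
theorem dY_w_wall (hX : 0 < X) (h : IsOleinikSolution X u w) (ht : 0 ≤ t)
    (hx : x ∈ Icc 0 X) : dY w t x 0 = 0 := by
  have hc : ContinuousOn (fun p : ℝ × ℝ => dY w p.1 p.2 0) (Ici 0 ×ˢ Icc 0 X) :=
    (h.contDiffOn_dY_w hX).continuousOn.comp (f := fun p : ℝ × ℝ => (p.1, p.2, (0 : ℝ)))
      (by fun_prop) fun p hp => ⟨hp.1, hp.2, by simp⟩
  have hEq : EqOn (fun p : ℝ × ℝ => dY w p.1 p.2 0) (fun _ => 0) (Ici 0 ×ˢ Icc 0 X) := by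
    refine EqOn.of_subset_closure (s := Ioi 0 ×ˢ Ioc 0 X)
      (fun p hp => h.dY_w_wall_interior hX hp.1 hp.2) hc continuousOn_const
      (prod_mono Ioi_subset_Ici_self Ioc_subset_Icc_self) ?_
    rw [closure_prod_eq, closure_Ioi, closure_Ioc hX.ne]
  exact hEq (show (t, x) ∈ Ici (0 : ℝ) ×ˢ Icc 0 X from ⟨ht, hx⟩)

end IsOleinikSolution

/-! ### The logarithmic barrier -/

/-- The profile `(1 - η) √(-ln (μ (1 - η)))`. -/
def barrier (μ η : ℝ) : ℝ := (1 - η) * Real.sqrt (-Real.log (μ * (1 - η)))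

section Barrier

variable {μ η : ℝ}

lemma one_lt_neg_log (hμ : μ ∈ Ioo (0 : ℝ) (1 / 100)) : 1 < -Real.log μ := by
  have h1 : μ < Real.exp (-1) := by
    refine hμ.2.trans ?_
    rw [Real.exp_neg, ← one_div]
    exact one_div_lt_one_div_of_lt (Real.exp_pos 1) (by linarith [Real.exp_one_lt_d9])
  have := (Real.log_lt_iff_lt_exp hμ.1).2 h1
  linarith

lemma neg_log_le_neg_log_mul (hμ : 0 < μ) (hη : η ∈ Ico (0 : ℝ) 1) :
    -Real.log μ ≤ -Real.log (μ * (1 - η)) := by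
  have : Real.log (μ * (1 - η)) ≤ Real.log μ :=
    Real.log_le_log (mul_pos hμ (by linarith [hη.2])) (by nlinarith [hη.1])
  linarith

lemma barrier_nonneg (hη : η < 1) : 0 ≤ barrier μ η :=
  mul_nonneg (by linarith) (Real.sqrt_nonneg _)

lemma hasDerivAt_neg_log (hμ : 0 < μ) (hη : η < 1) :
    HasDerivAt (fun s => -Real.log (μ * (1 - s))) (1 / (1 - η)) η := by
  have hx : 0 < 1 - η := by linarith
  have h1 : HasDerivAt (fun s : ℝ => μ * (1 - s)) (μ * (-1)) η :=
    ((hasDerivAt_id η).const_sub 1).const_mul μ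
  refine (h1.log (mul_pos hμ hx).ne').neg.congr_deriv ?_
  have := hμ.ne'
  field_simp

lemma hasDerivAt_sqrt_neg_log (hμ : μ ∈ Ioo (0 : ℝ) (1 / 100)) (hη : η ∈ Ico (0 : ℝ) 1) :
    HasDerivAt (fun s => Real.sqrt (-Real.log (μ * (1 - s))))
      (1 / (1 - η) / (2 * Real.sqrt (-Real.log (μ * (1 - η))))) η :=
  (hasDerivAt_neg_log hμ.1 hη.2).sqrt
    (by linarith [one_lt_neg_log hμ, neg_log_le_neg_log_mul hμ.1 hη])

lemma one_lt_sqrt_neg_log (hμ : μ ∈ Ioo (0 : ℝ) (1 / 100)) (hη : η ∈ Ico (0 : ℝ) 1) :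
    1 < Real.sqrt (-Real.log (μ * (1 - η))) := by
  rw [Real.lt_sqrt zero_le_one]
  linarith [one_lt_neg_log hμ, neg_log_le_neg_log_mul hμ.1 hη]

lemma hasDerivAt_barrier (hμ : μ ∈ Ioo (0 : ℝ) (1 / 100)) (hη : η ∈ Ico (0 : ℝ) 1) :
    HasDerivAt (barrier μ) (-Real.sqrt (-Real.log (μ * (1 - η)))
      + 1 / (2 * Real.sqrt (-Real.log (μ * (1 - η))))) η := by
  have hx : 0 < 1 - η := by linarith [hη.2]
  have hs := one_lt_sqrt_neg_log hμ hη
  have h1 : HasDerivAt (barrier μ) _ η :=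
    ((hasDerivAt_id η).const_sub 1).mul (hasDerivAt_sqrt_neg_log hμ hη)
  refine h1.congr_deriv ?_
  simp only [id_eq]
  field_simp

/-- With `s = √(-ln (μ (1 - η)))`, the barrier has slope `-s + 1 / (2 s)`. As `s` increases with
`η`, the slope decreases, so the barrier is concave. -/
lemma hasDerivAt_barrier_deriv (hμ : μ ∈ Ioo (0 : ℝ) (1 / 100)) (hη : η ∈ Ico (0 : ℝ) 1) :
    ∃ d ≤ 0, HasDerivAt (fun s => -Real.sqrt (-Real.log (μ * (1 - s)))
      + 1 / (2 * Real.sqrt (-Real.log (μ * (1 - s))))) d η := by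
  have hx : 0 < 1 - η := by linarith [hη.2]
  have hs := one_lt_sqrt_neg_log hμ hη
  have h1 := hasDerivAt_sqrt_neg_log hμ hη
  have h2 := h1.neg.add ((h1.const_mul 2).inv (by linarith))
  refine ⟨_, ?_, h2.congr_of_eventuallyEq (Eventually.of_forall fun s => ?_)⟩
  · have hd : 0 ≤ 1 / (1 - η) / (2 * Real.sqrt (-Real.log (μ * (1 - η)))) := by positivity
    have h3 : 0 ≤ 2 * (1 / (1 - η) / (2 * Real.sqrt (-Real.log (μ * (1 - η)))))
        / (2 * Real.sqrt (-Real.log (μ * (1 - η)))) ^ 2 := by positivity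
    rw [neg_div]
    linarith
  · simp

/-- This follows from `ln z ≤ z^s / s` at `z = 1 / (μ (1 - η))` and `s = 2 (1 - α)`; the square root
halves the exponent. The case `α = 1/2` gives the edge limit and boundedness, and `α = α₀` puts the
initial difference under the decaying supersolution. -/
lemma barrier_le_rpow {α : ℝ} (hμ : 0 < μ) (hα : α < 1) (hη : η < 1) :
    barrier μ η ≤ μ ^ (-(1 - α)) / Real.sqrt (2 * (1 - α)) * (1 - η) ^ α := by
  have hx : 0 < 1 - η := by linarith
  have hs : 0 < 2 * (1 - α) := by linarith
  have hp : 0 < μ * (1 - η) := mul_pos hμ hx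
  have h1 : -Real.log (μ * (1 - η)) ≤ (μ * (1 - η))⁻¹ ^ (2 * (1 - α)) / (2 * (1 - α)) := by
    rw [← Real.log_inv]
    exact Real.log_le_rpow_div (by positivity) hs
  have h2 : Real.sqrt (-Real.log (μ * (1 - η)))
      ≤ μ ^ (-(1 - α)) * (1 - η) ^ (-(1 - α)) / Real.sqrt (2 * (1 - α)) := by
    refine (Real.sqrt_le_sqrt h1).trans_eq ?_
    rw [Real.sqrt_div (by positivity), ← Real.mul_rpow hμ.le hx.le]
    congr 1
    rw [Real.sqrt_eq_iff_mul_self_eq (by positivity) (by positivity), ← Real.rpow_add hp,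
      Real.inv_rpow hp.le, ← Real.rpow_neg hp.le]
    congr 1; ring
  calc barrier μ η ≤ (1 - η) * (μ ^ (-(1 - α)) * (1 - η) ^ (-(1 - α)) / Real.sqrt (2 * (1 - α))) :=
        mul_le_mul_of_nonneg_left h2 hx.le
    _ = μ ^ (-(1 - α)) / Real.sqrt (2 * (1 - α)) * ((1 - η) ^ (1 : ℝ) * (1 - η) ^ (-(1 - α))) := by
        rw [Real.rpow_one]; ring
    _ = _ := by rw [← Real.rpow_add hx]; congr 2; ring

lemma tendsto_barrier (hμ : 0 < μ) : Tendsto (barrier μ) (𝓝[Ico 0 1] 1) (𝓝 0) := by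
  have h1 : Continuous fun s : ℝ => μ ^ (-(1 - 1 / 2 : ℝ)) / Real.sqrt (2 * (1 - 1 / 2))
      * (1 - s) ^ (1 / 2 : ℝ) :=
    continuous_const.mul ((continuous_const.sub continuous_id).rpow_const
      fun _ => Or.inr (by norm_num))
  have h2 := (h1.tendsto 1).mono_left (nhdsWithin_le_nhds (s := Ico 0 1))
  simp only [sub_self, Real.zero_rpow (by norm_num : (1 / 2 : ℝ) ≠ 0), mul_zero] at h2
  refine tendsto_of_tendsto_of_tendsto_of_le_of_le' tendsto_const_nhds h2 ?_ ?_
  · filter_upwards [self_mem_nhdsWithin] with s hs using barrier_nonneg hs.2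
  · filter_upwards [self_mem_nhdsWithin] with s hs
    exact barrier_le_rpow hμ (by norm_num) hs.2

lemma exists_barrier_bound (hμ : 0 < μ) : ∃ B > 0, ∀ η ∈ Ico (0 : ℝ) 1, barrier μ η ≤ B := by
  refine ⟨μ ^ (-(1 - 1 / 2 : ℝ)) / Real.sqrt (2 * (1 - 1 / 2)), by positivity, fun η hη => ?_⟩
  refine (barrier_le_rpow (α := 1 / 2) hμ (by norm_num) hη.2).trans ?_
  refine mul_le_of_le_one_right (by positivity) (Real.rpow_le_one ?_ ?_ ?_) <;>
    linarith [hη.1, hη.2]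

end Barrier

/-- The two-sided bound on `w` on the parabolic boundary `{τ = 0} ∪ {ξ = 0}`. -/
def DataEnvelope (X μ c₀ : ℝ) (w : ℝ → ℝ → ℝ → ℝ) : Prop :=
  ∀ τ ≥ 0, ∀ ξ ∈ Icc 0 X, ∀ η ∈ Ico (0 : ℝ) 1, (τ = 0 ∨ ξ = 0) →
    c₀ * (1 - η) ≤ w τ ξ η ∧ w τ ξ η ≤ c₀⁻¹ * barrier μ η

lemma DataBounds.envelope {X μ c₀ α₀ C₁ b : ℝ} {w : ℝ → ℝ → ℝ → ℝ}
    (h : DataBounds X μ c₀ α₀ C₁ b w) : DataEnvelope X μ c₀ w := by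
  intro τ hτ ξ hξ η hη hb
  have := (h τ hτ ξ hξ η hη hb).1
  rwa [mul_assoc] at this

lemma tendsto_trd_croccoDomain (X τ ξ : ℝ) :
    Tendsto (fun p : ℝ × ℝ × ℝ => p.2.2) (𝓝[croccoDomain X] (τ, ξ, 1)) (𝓝[Ico 0 1] 1) :=
  tendsto_nhdsWithin_of_tendsto_nhds_of_eventually_within _
    (tendsto_nhdsWithin_of_tendsto_nhds (continuous_snd.snd.tendsto (τ, ξ, (1 : ℝ))))
    (eventually_mem_nhdsWithin.mono fun _ hp => hp.2.2)

/-- The constant `β` of the stability theorem. -/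
def betaConst (μ c₀ : ℝ) : ℝ := 6 * c₀⁻¹ ^ 2 * (1 - Real.log μ)

lemma betaConst_pos {μ c₀ : ℝ} (hμ : μ ∈ Ioo (0 : ℝ) (1 / 100)) (hc₀ : 0 < c₀) :
    0 < betaConst μ c₀ := by
  have h1 : 0 < 1 - Real.log μ := by linarith [one_lt_neg_log hμ]
  have : 0 < c₀⁻¹ := inv_pos.2 hc₀
  rw [betaConst]; positivity

lemma bConst_pos {c₀ : ℝ} (β X : ℝ) (hc₀ : 0 < c₀) : 0 < bConst c₀ β X := by
  rw [bConst]; positivity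

/-- One of the two factors `1 - η` absorbs the logarithm, through `-x ln x ≤ 1`; the other survives.
-/
lemma barrier_sq_le {μ η : ℝ} (hμ : μ ∈ Ioo (0 : ℝ) (1 / 100)) (hη : η ∈ Ico (0 : ℝ) 1) :
    barrier μ η ^ 2 ≤ (1 - Real.log μ) * (1 - η) := by
  have hx : 0 < 1 - η := by linarith [hη.2]
  have h1 := one_lt_neg_log hμ
  have h2 := neg_log_le_neg_log_mul hμ.1 hη
  rw [barrier, mul_pow, Real.sq_sqrt (by linarith), Real.log_mul hμ.1.ne' hx.ne']
  have h3 := Real.one_sub_inv_le_log_of_pos hx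
  have h4 : -((1 - η) * Real.log (1 - η)) ≤ 1 := by
    have := mul_le_mul_of_nonneg_left h3 hx.le
    rw [mul_sub, mul_inv_cancel₀ hx.ne'] at this
    linarith
  have h5 : (1 - η) * -Real.log μ ≤ -Real.log μ :=
    mul_le_of_le_one_left (by linarith) (by linarith [hη.1])
  have : (1 - η) * ((1 - η) * -Real.log μ + -((1 - η) * Real.log (1 - η)))
      ≤ (1 - η) * (-Real.log μ + 1) := mul_le_mul_of_nonneg_left (add_le_add h5 h4) hx.le
  linarith

lemma pow_three_le_self {η : ℝ} (hη : η ∈ Ico (0 : ℝ) 1) : η ^ 3 ≤ η :=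
  pow_le_of_le_one hη.1 hη.2.le (by norm_num)

/-! ### Global two-sided bounds on `w` -/

namespace IsOleinikSolution

variable {X μ c₀ : ℝ} {u w : ℝ → ℝ → ℝ → ℝ}

/-- A concave profile with nonpositive slope at the wall is a stationary supersolution whatever the
diffusion coefficient `w²`. -/
theorem w_le_barrier (hX : 0 < X) (hμ : μ ∈ Ioo (0 : ℝ) (1 / 100)) (hc₀ : 0 < c₀)
    (h : IsOleinikSolution X u w) (hd : DataEnvelope X μ c₀ w) :
    ∀ τ ≥ 0, ∀ ξ ∈ Icc 0 X, ∀ η ∈ Ico (0 : ℝ) 1, w τ ξ η ≤ c₀⁻¹ * barrier μ η := by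
  have hci : 0 < c₀⁻¹ := inv_pos.2 hc₀
  have key := max_principle (X := X) (W := fun τ ξ η => w τ ξ η - c₀⁻¹ * barrier μ η)
    (Wy := fun τ ξ η => dY w τ ξ η - c₀⁻¹ * (-Real.sqrt (-Real.log (μ * (1 - η)))
      + 1 / (2 * Real.sqrt (-Real.log (μ * (1 - η))))))
    (l := fun _ _ => 0) (fun _ _ _ _ => le_rfl) continuous_const
    (h.contDiffOn_w.continuousOn.sub (continuousOn_const.mul ?_)) ?_ ?_ ?_ ?_ ?_ ?_
  · intro τ hτ ξ hξ η hη
    linarith [key τ hτ ξ hξ η hη]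
  · exact ContinuousOn.comp (t := Ico 0 1)
      (fun s hs => (hasDerivAt_barrier hμ hs).continuousAt.continuousWithinAt)
      continuous_snd.snd.continuousOn fun p hp => hp.2.2
  · intro τ hτ ξ hξ
    have h1 := (h.edge_w τ hτ ξ hξ).sub
      (((tendsto_barrier hμ.1).comp (tendsto_trd_croccoDomain X τ ξ)).const_mul c₀⁻¹)
    rw [mul_zero, sub_zero] at h1
    exact h1
  · intro ξ hξ η hη
    linarith [(hd 0 le_rfl ξ hξ η hη (Or.inl rfl)).2]
  · intro τ hτ η hη
    linarith [(hd τ hτ 0 ⟨le_rfl, hX.le⟩ η hη (Or.inr rfl)).2]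
  · intro τ hτ ξ hξ η hη
    exact (h.hasDerivWithinAt_w hτ.le (Ioc_subset_Icc_self hξ) hη).sub
      ((hasDerivAt_barrier hμ hη).hasDerivWithinAt.const_mul _)
  · intro τ hτ ξ hξ
    rw [h.dY_w_wall hX hτ.le (Ioc_subset_Icc_self hξ)]
    have hs := one_lt_sqrt_neg_log hμ (⟨le_rfl, one_pos⟩ : (0 : ℝ) ∈ Ico (0 : ℝ) 1)
    have h1 : 1 / (2 * Real.sqrt (-Real.log (μ * (1 - 0)))) ≤ 1 := by
      rw [div_le_one (by linarith)]; linarith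
    have h2 := add_le_add (neg_le_neg hs.le) h1
    rw [neg_add_cancel] at h2
    rw [zero_sub, ← mul_neg]
    exact mul_nonneg hci.le (neg_nonneg.2 h2)
  · intro τ hτ ξ hξ η hη _
    have hξ' := Ioc_subset_Icc_self hξ
    obtain ⟨d, hd0, hd2⟩ := hasDerivAt_barrier_deriv hμ hη
    refine ⟨w τ ξ η ^ 2, dT w τ ξ η, dX X w τ ξ η, dYY w τ ξ η - c₀⁻¹ * d, sq_nonneg _,
      (hasDerivWithinAt_dT h.differentiableOn_w hτ.le hξ' hη).sub_const _,
      (hasDerivWithinAt_dX hX h.differentiableOn_w hτ.le hξ' hη).sub_const _,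
      (h.hasDerivWithinAt_dY_w hX hτ.le hξ' hη).sub (hd2.hasDerivWithinAt.const_mul _), ?_⟩
    rw [h.crocco_equation hX hτ.le hξ' hη]
    have : 0 ≤ w τ ξ η ^ 2 * (c₀⁻¹ * -d) := by
      have := neg_nonneg.2 hd0; positivity
    nlinarith

/-- The cubic is chosen because it has zero slope at the wall and its second derivative `-6 η`
carries the same factor `η` as the transport term. The subsolution condition therefore reduces to `6
w² ≤ β (1 - η³)`, with no loss at `η = 0`. -/
theorem lower_bound (hX : 0 < X) (hμ : μ ∈ Ioo (0 : ℝ) (1 / 100)) (hc₀ : 0 < c₀)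
    (h : IsOleinikSolution X u w) (hd : DataEnvelope X μ c₀ w) :
    ∀ τ ≥ 0, ∀ ξ ∈ Icc 0 X, ∀ η ∈ Ico (0 : ℝ) 1,
      c₀ / 3 * Real.exp (-(betaConst μ c₀ * ξ)) * (1 - η ^ 3) ≤ w τ ξ η := by
  set β := betaConst μ c₀ with hβ
  have hβ0 : 0 < β := betaConst_pos hμ hc₀
  have hupper := h.w_le_barrier hX hμ hc₀ hd
  have hdata : ∀ τ ≥ 0, ∀ ξ ∈ Icc 0 X, ∀ η ∈ Ico (0 : ℝ) 1, (τ = 0 ∨ ξ = 0) →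
      c₀ / 3 * Real.exp (-(β * ξ)) * (1 - η ^ 3) - w τ ξ η ≤ 0 := by
    intro τ hτ ξ hξ η hη hb
    have h1 := (hd τ hτ ξ hξ η hη hb).1
    have h2 : Real.exp (-(β * ξ)) ≤ 1 := 
      Real.exp_le_one_iff.2 (by linarith [mul_nonneg hβ0.le hξ.1])
    have h3 : 0 ≤ 1 - η := by linarith [hη.2]
    -- This factor `3` explains the constant `c₀ / 3`.
    have h4 : 1 - η ^ 3 ≤ 3 * (1 - η) := by
      nlinarith [hη.1, mul_nonneg h3 h3, mul_nonneg hη.1 (mul_nonneg h3 h3)]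
    have h5 : 0 ≤ 1 - η ^ 3 := by linarith [pow_three_le_self hη]
    have h6 : c₀ / 3 * Real.exp (-(β * ξ)) * (1 - η ^ 3) ≤ c₀ / 3 * 1 * (3 * (1 - η)) := by
      gcongr
    linarith
  have key := max_principle (X := X)
    (W := fun τ ξ η => c₀ / 3 * Real.exp (-(β * ξ)) * (1 - η ^ 3) - w τ ξ η)
    (Wy := fun τ ξ η => c₀ / 3 * Real.exp (-(β * ξ)) * (-(3 * η ^ 2)) - dY w τ ξ η)
    (l := fun _ _ => 0) (fun _ _ _ _ => le_rfl) continuous_const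
    (ContinuousOn.sub (by fun_prop) h.contDiffOn_w.continuousOn) ?_
    (fun ξ hξ η hη => hdata 0 le_rfl ξ hξ η hη (Or.inl rfl))
    (fun τ hτ η hη => hdata τ hτ 0 ⟨le_rfl, hX.le⟩ η hη (Or.inr rfl)) ?_ ?_ ?_
  · intro τ hτ ξ hξ η hη
    linarith [key τ hτ ξ hξ η hη]
  · intro τ hτ ξ hξ
    have hc : Continuous fun p : ℝ × ℝ × ℝ =>
      c₀ / 3 * Real.exp (-(β * p.2.1)) * (1 - p.2.2 ^ 3) := by fun_prop
    have h1 := (tendsto_nhdsWithin_of_tendsto_nhds (s := croccoDomain X)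
      (hc.tendsto (τ, ξ, 1))).sub (h.edge_w τ hτ ξ hξ)
    simp only [one_pow, sub_self, mul_zero] at h1
    exact h1
  · intro τ hτ ξ hξ η hη
    refine HasDerivWithinAt.sub ?_ (h.hasDerivWithinAt_w hτ.le (Ioc_subset_Icc_self hξ) hη)
    have h1 : HasDerivAt (fun s : ℝ => 1 - s ^ 3) (-(3 * η ^ 2)) η := by
      simpa using (hasDerivAt_pow 3 η).const_sub 1
    exact (h1.const_mul _).hasDerivWithinAt
  · intro τ hτ ξ hξ
    rw [h.dY_w_wall hX hτ.le (Ioc_subset_Icc_self hξ)]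
    simp
  · intro τ hτ ξ hξ η hη _
    have hξ' := Ioc_subset_Icc_self hξ
    have hx : 0 ≤ 1 - η := by linarith [hη.2]
    have hE := Real.exp_pos (-(β * ξ))
    set E := Real.exp (-(β * ξ)) with hEdef
    have hdx : HasDerivAt (fun s => c₀ / 3 * Real.exp (-(β * s)) * (1 - η ^ 3))
        (c₀ / 3 * (E * -β) * (1 - η ^ 3)) ξ := by
      have h1 : HasDerivAt (fun s : ℝ => -(β * s)) (-β) ξ :=
        (((hasDerivAt_id ξ).const_mul β).neg).congr_deriv (by simp)
      exact (h1.exp.const_mul _).mul_const _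
    have hdyy : HasDerivAt (fun s : ℝ => c₀ / 3 * E * (-(3 * s ^ 2)))
        (c₀ / 3 * E * (-(6 * η))) η := by
      have h1 : HasDerivAt (fun s : ℝ => -(3 * s ^ 2)) (-(6 * η)) η :=
        (((hasDerivAt_pow 2 η).const_mul 3).neg).congr_deriv (by norm_num; ring)
      exact h1.const_mul (c₀ / 3 * E)
    refine ⟨w τ ξ η ^ 2, 0 - dT w τ ξ η, c₀ / 3 * (E * -β) * (1 - η ^ 3) - dX X w τ ξ η,
      c₀ / 3 * E * (-(6 * η)) - dYY w τ ξ η, sq_nonneg _,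
      (hasDerivWithinAt_const _ _ _).sub
        (hasDerivWithinAt_dT h.differentiableOn_w hτ.le hξ' hη),
      hdx.hasDerivWithinAt.sub (hasDerivWithinAt_dX hX h.differentiableOn_w hτ.le hξ' hη),
      hdyy.hasDerivWithinAt.sub (h.hasDerivWithinAt_dY_w hX hτ.le hξ' hη), ?_⟩
    have heq := h.crocco_equation hX hτ.le hξ' hη
    -- This inequality dictates the value of `betaConst`: six times the squared upper barrier,
    -- bounded by `barrier_sq_le`.
    have hw2 : 6 * w τ ξ η ^ 2 ≤ β * (1 - η) := by
      have h1 := hupper τ hτ.le ξ hξ' η hη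
      have h2 := pow_le_pow_left₀ (h.w_pos hτ.le hξ' hη).le h1 2
      have h3 := mul_le_mul_of_nonneg_left (barrier_sq_le hμ hη) (sq_nonneg c₀⁻¹)
      rw [mul_pow] at h2
      rw [hβ, betaConst]
      linarith
    have h4 : β * (1 - η) ≤ β * (1 - η ^ 3) := by
      refine mul_le_mul_of_nonneg_left ?_ hβ0.le
      linarith [pow_three_le_self hη]
    have h5 : 0 ≤ c₀ / 3 * E * η * (β * (1 - η ^ 3) - 6 * w τ ξ η ^ 2) :=
      mul_nonneg (mul_nonneg (by positivity) hη.1) (by linarith)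
    linear_combination h5 - heq

/-- `bConst` is smaller than the constant in `lower_bound`. What matters is a bound linear in `1 -
η` and uniform in `ξ`. -/
theorem bConst_mul_le (hX : 0 < X) (hμ : μ ∈ Ioo (0 : ℝ) (1 / 100)) (hc₀ : 0 < c₀)
    (h : IsOleinikSolution X u w) (hd : DataEnvelope X μ c₀ w) :
    ∀ τ ≥ 0, ∀ ξ ∈ Icc 0 X, ∀ η ∈ Ico (0 : ℝ) 1,
      bConst c₀ (betaConst μ c₀) X * (1 - η) ≤ w τ ξ η := by
  intro τ hτ ξ hξ η hη
  refine le_trans ?_ (h.lower_bound hX hμ hc₀ hd τ hτ ξ hξ η hη)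
  have hβ0 := (betaConst_pos hμ hc₀).le
  have h1 : Real.exp (-(betaConst μ c₀ * X)) ≤ Real.exp (-(betaConst μ c₀ * ξ)) :=
    Real.exp_le_exp.2 (by nlinarith [hξ.2])
  have h2 : Real.exp (-(8 / 3)) ≤ 1 := Real.exp_le_one_iff.2 (by norm_num)
  have h3 : 1 - η ≤ 1 - η ^ 3 := by linarith [pow_three_le_self hη]
  have h4 : 0 ≤ 1 - η := by linarith [hη.2]
  have h5 : c₀ / 4 ≤ c₀ / 3 := by linarith
  rw [bConst]
  calc c₀ / 4 * Real.exp (-(betaConst μ c₀ * X)) * Real.exp (-(8 / 3)) * (1 - η)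
      ≤ c₀ / 3 * Real.exp (-(betaConst μ c₀ * ξ)) * 1 * (1 - η ^ 3) := by gcongr
    _ = _ := by ring

end IsOleinikSolution

/-! ### Comparison of `w` with the steady profile -/

section

variable {X : ℝ} {ubar wbar : ℝ → ℝ → ℝ} {u w : ℝ → ℝ → ℝ → ℝ}

lemma dYY_nonpos_of_concave (hX : 0 < X)
    (hs : IsOleinikSolution X (fun _ => ubar) (fun _ => wbar))
    (hconc : ∀ ξ ∈ Ioc 0 X, ∀ η ∈ Ioo (0 : ℝ) 1, dYY (fun _ => wbar) 0 ξ η ≤ 0) :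
    ∀ τ ≥ 0, ∀ ξ ∈ Icc 0 X, ∀ η ∈ Ico (0 : ℝ) 1, dYY (fun _ => wbar) τ ξ η ≤ 0 := by
  intro τ hτ ξ hξ η hη
  -- Writing the inequality as `max(·, 0) = 0` lets it pass to the closure as an identity of
  -- continuous functions.
  have hEq : EqOn (fun p => max (unc (dYY fun _ => wbar) p) 0) (fun _ => 0) (box X (Ico 0 1)) := by
    refine EqOn.of_subset_closure (s := Ioi 0 ×ˢ Ioc 0 X ×ˢ Ioo 0 1)
      (fun p hp => max_eq_right (hconc p.2.1 hp.2.1 p.2.2 hp.2.2))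
      ((hs.continuousOn_dYY_w hX).sup continuousOn_const) continuousOn_const
      (prod_mono Ioi_subset_Ici_self (prod_mono Ioc_subset_Icc_self Ioo_subset_Ico_self)) ?_
    rw [closure_prod_eq, closure_prod_eq, closure_Ioi, closure_Ioc hX.ne, closure_Ioo (by norm_num)]
    exact prod_mono subset_rfl (prod_mono subset_rfl Ico_subset_Icc_self)
  exact max_eq_right_iff.1 (hEq (show (τ, ξ, η) ∈ box X (Ico 0 1) from ⟨hτ, hξ, hη⟩))

/-- Comparison of `σ (w - w̄)` with a supersolution `A e^{-κ τ} g(η)`. -/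
lemma signed_diff_le (σ : ℝ) (hX : 0 < X)
    (hs : IsOleinikSolution X (fun _ => ubar) (fun _ => wbar)) (h : IsOleinikSolution X u w)
    (hconc : ∀ τ ≥ 0, ∀ ξ ∈ Icc 0 X, ∀ η ∈ Ico (0 : ℝ) 1, dYY (fun _ => wbar) τ ξ η ≤ 0)
    {b : ℝ} (hb : 0 ≤ b)
    (hlow : ∀ τ ≥ 0, ∀ ξ ∈ Icc 0 X, ∀ η ∈ Ico (0 : ℝ) 1, b * (1 - η) ≤ w τ ξ η)
    {A κ : ℝ} (hA : 0 ≤ A) {g g₁ g₂ : ℝ → ℝ} (hg : Continuous g)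
    (hg0 : ∀ η ∈ Icc (0 : ℝ) 1, 0 ≤ g η)
    (hg1 : ∀ η ∈ Ico (0 : ℝ) 1, HasDerivAt g (g₁ η) η) (hg1w : g₁ 0 ≤ 0)
    (hg2 : ∀ η ∈ Ico (0 : ℝ) 1, HasDerivAt g₁ (g₂ η) η) (hg2n : ∀ η ∈ Ico (0 : ℝ) 1, g₂ η ≤ 0)
    (hsup : ∀ η ∈ Ico (0 : ℝ) 1, κ * g η + (b * (1 - η)) ^ 2 * g₂ η ≤ 0)
    (hinit : ∀ ξ ∈ Icc 0 X, ∀ η ∈ Ico (0 : ℝ) 1, σ * (w 0 ξ η - wbar ξ η) ≤ A * g η)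
    (hin : ∀ τ ≥ 0, ∀ η ∈ Ico (0 : ℝ) 1,
      σ * (w τ 0 η - wbar 0 η) ≤ A * Real.exp (-(κ * τ)) * g η) :
    ∀ τ ≥ 0, ∀ ξ ∈ Icc 0 X, ∀ η ∈ Ico (0 : ℝ) 1,
      σ * (w τ ξ η - wbar ξ η) ≤ A * Real.exp (-(κ * τ)) * g η := by
  have hwb := hs.contDiffOn_w.continuousOn
  have key := max_principle (X := X)
    (W := fun τ ξ η => σ * (w τ ξ η - wbar ξ η) - A * Real.exp (-(κ * τ)) * g η)
    (Wy := fun τ ξ η => σ * (dY w τ ξ η - dY (fun _ => wbar) τ ξ η)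
      - A * Real.exp (-(κ * τ)) * g₁ η)
    -- Both profiles vanish at the edge, but `g` need not (for instance `g = 1`), so the edge value
    -- of `W` is only nonpositive.
    (l := fun τ _ => σ * (0 - 0) - A * Real.exp (-(κ * τ)) * g 1) ?_ (by fun_prop)
    (ContinuousOn.sub (continuousOn_const.mul (h.contDiffOn_w.continuousOn.sub hwb))
      (by fun_prop)) ?_ ?_ ?_ ?_ ?_ ?_
  · intro τ hτ ξ hξ η hη
    exact sub_nonpos.1 (key τ hτ ξ hξ η hη)
  · intro τ _ ξ _
    have := hg0 1 ⟨zero_le_one, le_rfl⟩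
    have : 0 ≤ A * Real.exp (-(κ * τ)) * g 1 := by positivity
    linarith
  · intro τ hτ ξ hξ
    have hc : Continuous fun p : ℝ × ℝ × ℝ => A * Real.exp (-(κ * p.1)) * g p.2.2 := by fun_prop
    exact (((h.edge_w τ hτ ξ hξ).sub (hs.edge_w τ hτ ξ hξ)).const_mul σ).sub
      (tendsto_nhdsWithin_of_tendsto_nhds (hc.tendsto (τ, ξ, 1)))
  · intro ξ hξ η hη
    simpa using hinit ξ hξ η hη
  · intro τ hτ η hη
    exact sub_nonpos.2 (hin τ hτ η hη)
  · intro τ hτ ξ hξ η hη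
    have hξ' := Ioc_subset_Icc_self hξ
    exact (((h.hasDerivWithinAt_w hτ.le hξ' hη).sub
      (hs.hasDerivWithinAt_w hτ.le hξ' hη)).const_mul σ).sub
      ((hg1 η hη).hasDerivWithinAt.const_mul _)
  · intro τ hτ ξ hξ
    have hξ' := Ioc_subset_Icc_self hξ
    simp only [h.dY_w_wall hX hτ.le hξ', hs.dY_w_wall hX hτ.le hξ', sub_self, mul_zero, zero_sub]
    have := neg_nonneg.2 hg1w
    rw [← mul_neg]
    positivity
  · intro τ hτ ξ hξ η hη hpos
    have hξ' := Ioc_subset_Icc_self hξ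
    have hE := Real.exp_pos (-(κ * τ))
    set E := Real.exp (-(κ * τ)) with hEdef
    have hexp : HasDerivAt (fun s => A * Real.exp (-(κ * s)) * g η) (A * (E * -κ) * g η) τ := by
      have h1 : HasDerivAt (fun s : ℝ => -(κ * s)) (-κ) τ :=
        (((hasDerivAt_id τ).const_mul κ).neg).congr_deriv (by simp)
      exact (h1.exp.const_mul _).mul_const _
    refine ⟨w τ ξ η ^ 2, σ * dT w τ ξ η - A * (E * -κ) * g η,
      σ * (dX X w τ ξ η - dX X (fun _ => wbar) τ ξ η),
      σ * (dYY w τ ξ η - dYY (fun _ => wbar) τ ξ η) - A * E * g₂ η, sq_nonneg _,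
      (((hasDerivWithinAt_dT h.differentiableOn_w hτ.le hξ' hη).sub_const _).const_mul σ).sub
        hexp.hasDerivWithinAt,
      (((hasDerivWithinAt_dX hX h.differentiableOn_w hτ.le hξ' hη).sub
        (hasDerivWithinAt_dX hX hs.differentiableOn_w hτ.le hξ' hη)).const_mul σ).sub_const _,
      (((h.hasDerivWithinAt_dY_w hX hτ.le hξ' hη).sub
        (hs.hasDerivWithinAt_dY_w hX hτ.le hξ' hη)).const_mul σ).sub
        ((hg2 η hη).hasDerivWithinAt.const_mul _), ?_⟩
    have e1 := h.crocco_equation hX hτ.le hξ' hη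
    have e2 := hs.crocco_equation hX hτ.le hξ' hη
    have e3 : dT (fun _ => wbar) τ ξ η = 0 := by simp [dT]
    rw [e3, zero_add] at e2
    have hgη := hg0 η (Ico_subset_Icc_self hη)
    have hdiff : 0 ≤ σ * (w τ ξ η - wbar ξ η) := by
      have : 0 ≤ A * E * g η := by positivity
      linarith
    have hsum : 0 ≤ w τ ξ η + wbar ξ η :=
      add_nonneg (h.w_pos hτ.le hξ' hη).le (hs.w_pos hτ.le hξ' hη).le
    -- This is the zeroth-order term of the equation for the difference. Its sign comes from
    -- concavity together with `σ (w - w̄) ≥ 0`, which is known only where `W > 0`.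
    have i1 : 0 ≤ σ * (w τ ξ η - wbar ξ η) * (w τ ξ η + wbar ξ η)
        * (-dYY (fun _ => wbar) τ ξ η) :=
      mul_nonneg (mul_nonneg hdiff hsum) (neg_nonneg.2 (hconc τ hτ.le ξ hξ' η hη))
    have hx : 0 ≤ 1 - η := by linarith [hη.2]
    have i2 : (b * (1 - η)) ^ 2 ≤ w τ ξ η ^ 2 :=
      pow_le_pow_left₀ (mul_nonneg hb hx) (hlow τ hτ.le ξ hξ' η hη) 2
    have i3 : κ * g η + w τ ξ η ^ 2 * g₂ η ≤ 0 := by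
      have := mul_le_mul_of_nonpos_right i2 (hg2n η hη)
      linarith [hsup η hη]
    have i4 : 0 ≤ A * E * -(κ * g η + w τ ξ η ^ 2 * g₂ η) :=
      mul_nonneg (by positivity) (by linarith)
    linear_combination i1 + i4 + σ * e1 - σ * e2

/-- Comparison of `|w - w̄|` with a supersolution `A e^{-κ τ} g(η)`. -/
theorem abs_diff_le (hX : 0 < X)
    (hs : IsOleinikSolution X (fun _ => ubar) (fun _ => wbar)) (h : IsOleinikSolution X u w)
    (hconc : ∀ τ ≥ 0, ∀ ξ ∈ Icc 0 X, ∀ η ∈ Ico (0 : ℝ) 1, dYY (fun _ => wbar) τ ξ η ≤ 0)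
    {b : ℝ} (hb : 0 ≤ b)
    (hlow : ∀ τ ≥ 0, ∀ ξ ∈ Icc 0 X, ∀ η ∈ Ico (0 : ℝ) 1, b * (1 - η) ≤ w τ ξ η)
    {A κ : ℝ} (hA : 0 ≤ A) {g g₁ g₂ : ℝ → ℝ} (hg : Continuous g)
    (hg0 : ∀ η ∈ Icc (0 : ℝ) 1, 0 ≤ g η)
    (hg1 : ∀ η ∈ Ico (0 : ℝ) 1, HasDerivAt g (g₁ η) η) (hg1w : g₁ 0 ≤ 0)
    (hg2 : ∀ η ∈ Ico (0 : ℝ) 1, HasDerivAt g₁ (g₂ η) η) (hg2n : ∀ η ∈ Ico (0 : ℝ) 1, g₂ η ≤ 0)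
    (hsup : ∀ η ∈ Ico (0 : ℝ) 1, κ * g η + (b * (1 - η)) ^ 2 * g₂ η ≤ 0)
    (hinit : ∀ ξ ∈ Icc 0 X, ∀ η ∈ Ico (0 : ℝ) 1, |w 0 ξ η - wbar ξ η| ≤ A * g η)
    (hin : ∀ τ ≥ 0, ∀ η ∈ Ico (0 : ℝ) 1,
      |w τ 0 η - wbar 0 η| ≤ A * Real.exp (-(κ * τ)) * g η) :
    ∀ τ ≥ 0, ∀ ξ ∈ Icc 0 X, ∀ η ∈ Ico (0 : ℝ) 1,
      |w τ ξ η - wbar ξ η| ≤ A * Real.exp (-(κ * τ)) * g η := by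
  have hσ : ∀ σ : ℝ, σ = 1 ∨ σ = -1 → ∀ z : ℝ, σ * z ≤ |z| := by
    rintro σ (rfl | rfl) z
    · simpa using le_abs_self z
    · simpa using neg_le_abs z
  have key : ∀ σ : ℝ, σ = 1 ∨ σ = -1 → ∀ τ ≥ 0, ∀ ξ ∈ Icc 0 X, ∀ η ∈ Ico (0 : ℝ) 1,
      σ * (w τ ξ η - wbar ξ η) ≤ A * Real.exp (-(κ * τ)) * g η := fun σ h1 =>
    signed_diff_le σ hX hs h hconc hb hlow hA hg hg0 hg1 hg1w hg2 hg2n hsup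
      (fun ξ hξ η hη => (hσ σ h1 _).trans (hinit ξ hξ η hη))
      (fun τ hτ η hη => (hσ σ h1 _).trans (hin τ hτ η hη))
  intro τ hτ ξ hξ η hη
  rw [abs_le']
  exact ⟨by simpa using key 1 (Or.inl rfl) τ hτ ξ hξ η hη,
    by simpa using key (-1) (Or.inr rfl) τ hτ ξ hξ η hη⟩

/-- The supersolution is the constant `M`. As `g'' = 0` and `κ = 0`, positivity of `w` suffices,
hence the choice `b = 0`. -/
theorem abs_diff_le_const (hX : 0 < X)
    (hs : IsOleinikSolution X (fun _ => ubar) (fun _ => wbar)) (h : IsOleinikSolution X u w)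
    (hconc : ∀ τ ≥ 0, ∀ ξ ∈ Icc 0 X, ∀ η ∈ Ico (0 : ℝ) 1, dYY (fun _ => wbar) τ ξ η ≤ 0)
    {M : ℝ} (hM : 0 ≤ M)
    (hinit : ∀ ξ ∈ Icc 0 X, ∀ η ∈ Ico (0 : ℝ) 1, |w 0 ξ η - wbar ξ η| ≤ M)
    (hin : ∀ τ ≥ 0, ∀ η ∈ Ico (0 : ℝ) 1, |w τ 0 η - wbar 0 η| ≤ M) :
    ∀ τ ≥ 0, ∀ ξ ∈ Icc 0 X, ∀ η ∈ Ico (0 : ℝ) 1, |w τ ξ η - wbar ξ η| ≤ M := by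
  have := abs_diff_le (b := 0) (A := M) (κ := 0) (g := fun _ => 1) (g₁ := fun _ => 0)
    (g₂ := fun _ => 0) hX hs h hconc le_rfl
    (fun τ hτ ξ hξ η hη => by rw [zero_mul]; exact (h.w_pos hτ hξ hη).le) hM continuous_const
    (fun _ _ => zero_le_one) (fun η _ => hasDerivAt_const η _) le_rfl
    (fun η _ => hasDerivAt_const η _) (fun _ _ => le_rfl) (by simp)
    (by simpa using hinit) (by simpa using hin)
  simpa using this

/-- Two derivatives of `(1 - η)^α` cost the factor `(1 - η)^(-2)`, which the degenerate diffusion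
`b² (1 - η)²` restores exactly. What remains is the damping rate `b² α (1 - α)`. -/
theorem abs_diff_le_exp (hX : 0 < X)
    (hs : IsOleinikSolution X (fun _ => ubar) (fun _ => wbar)) (h : IsOleinikSolution X u w)
    (hconc : ∀ τ ≥ 0, ∀ ξ ∈ Icc 0 X, ∀ η ∈ Ico (0 : ℝ) 1, dYY (fun _ => wbar) τ ξ η ≤ 0)
    {b : ℝ} (hb : 0 ≤ b)
    (hlow : ∀ τ ≥ 0, ∀ ξ ∈ Icc 0 X, ∀ η ∈ Ico (0 : ℝ) 1, b * (1 - η) ≤ w τ ξ η)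
    {A κ α : ℝ} (hA : 0 ≤ A) (hα : α ∈ Ioo (0 : ℝ) 1) (hκ : κ ≤ b ^ 2 * α * (1 - α))
    (hinit : ∀ ξ ∈ Icc 0 X, ∀ η ∈ Ico (0 : ℝ) 1, |w 0 ξ η - wbar ξ η| ≤ A * (1 - η) ^ α)
    (hin : ∀ τ ≥ 0, ∀ η ∈ Ico (0 : ℝ) 1,
      |w τ 0 η - wbar 0 η| ≤ A * Real.exp (-(κ * τ)) * (1 - η) ^ α) :
    ∀ τ ≥ 0, ∀ ξ ∈ Icc 0 X, ∀ η ∈ Ico (0 : ℝ) 1,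
      |w τ ξ η - wbar ξ η| ≤ A * Real.exp (-(κ * τ)) * (1 - η) ^ α := by
  have hder : ∀ p : ℝ, ∀ η ∈ Ico (0 : ℝ) 1,
      HasDerivAt (fun s : ℝ => (1 - s) ^ p) (-(p * (1 - η) ^ (p - 1))) η := fun p η hη =>
    (((hasDerivAt_id η).const_sub 1).rpow_const
      (Or.inl (by simp only [id_eq]; linarith [hη.2]))).congr_deriv (by simp)
  refine abs_diff_le (b := b) (A := A) (κ := κ) (g := fun η => (1 - η) ^ α)
    (g₁ := fun η => -(α * (1 - η) ^ (α - 1)))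
    (g₂ := fun η => -(α * -((α - 1) * (1 - η) ^ (α - 1 - 1)))) hX hs h hconc hb hlow hA
    ((continuous_const.sub continuous_id).rpow_const fun _ => Or.inr hα.1.le)
    (fun η hη => Real.rpow_nonneg (by linarith [hη.2]) _) (hder α) ?_
    (fun η hη => ((hder (α - 1) η hη).const_mul α).neg) ?_ ?_ hinit hin
  · simpa using hα.1.le
  · intro η hη
    have h1 : 0 ≤ (1 - η) ^ (α - 1 - 1) := Real.rpow_nonneg (by linarith [hη.2]) _
    have h2 : 0 ≤ α * ((1 - α) * (1 - η) ^ (α - 1 - 1)) :=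
      mul_nonneg hα.1.le (mul_nonneg (by linarith [hα.2]) h1)
    linarith
  · intro η hη
    have hx : 0 < 1 - η := by linarith [hη.2]
    have h1 : (1 - η) ^ α = (1 - η) ^ 2 * (1 - η) ^ (α - 1 - 1) := by
      rw [← Real.rpow_natCast (1 - η) 2, ← Real.rpow_add hx]
      congr 1; push_cast; ring
    have h2 : κ * (1 - η) ^ α ≤ b ^ 2 * α * (1 - α) * (1 - η) ^ α :=
      mul_le_mul_of_nonneg_right hκ (Real.rpow_nonneg hx.le _)
    rw [h1] at h2 ⊢
    linarith

/-- A concave steady profile is Lipschitz away from the edge. -/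
lemma abs_dY_wbar_le (hX : 0 < X)
    (hs : IsOleinikSolution X (fun _ => ubar) (fun _ => wbar))
    (hconc : ∀ τ ≥ 0, ∀ ξ ∈ Icc 0 X, ∀ η ∈ Ico (0 : ℝ) 1, dYY (fun _ => wbar) τ ξ η ≤ 0)
    {B ξ η : ℝ} (hξ : ξ ∈ Icc 0 X) (hB : ∀ η ∈ Ico (0 : ℝ) 1, wbar ξ η ≤ B)
    (hη : η ∈ Ico (0 : ℝ) 1) : |dY (fun _ => wbar) 0 ξ η| ≤ 2 * B / (1 - η) := by
  have hd : ∀ z ∈ Ico (0 : ℝ) 1,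
      HasDerivWithinAt (wbar ξ) (dY (fun _ => wbar) 0 ξ z) (Ici 0) z := fun z hz =>
    hs.hasDerivWithinAt_w le_rfl hξ hz
  have hanti : AntitoneOn (dY (fun _ => wbar) 0 ξ) (Ico 0 1) := by
    have hd2 : ∀ z ∈ Ico (0 : ℝ) 1, HasDerivWithinAt (dY (fun _ => wbar) 0 ξ)
      (dYY (fun _ => wbar) 0 ξ z) (Ici 0) z := fun z hz => hs.hasDerivWithinAt_dY_w hX le_rfl hξ hz
    refine antitoneOn_of_deriv_nonpos (convex_Ico 0 1)
      (fun z hz => (hd2 z hz).continuousWithinAt.mono fun r hr => hr.1) ?_ ?_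
    · intro z hz
      rw [interior_Ico] at hz
      exact ((hd2 z (Ioo_subset_Ico_self hz)).hasDerivAt
        (Ici_mem_nhds hz.1)).differentiableAt.differentiableWithinAt
    · intro z hz
      rw [interior_Ico] at hz
      rw [((hd2 z (Ioo_subset_Ico_self hz)).hasDerivAt (Ici_mem_nhds hz.1)).deriv]
      exact hconc 0 le_rfl ξ hξ z (Ioo_subset_Ico_self hz)
  have hx : 0 < 1 - η := by linarith [hη.2]
  have hnp : dY (fun _ => wbar) 0 ξ η ≤ 0 := by
    have := hanti (⟨le_rfl, one_pos⟩ : (0 : ℝ) ∈ Ico (0 : ℝ) 1) hη hη.1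
    rwa [hs.dY_w_wall hX le_rfl hξ] at this
  -- By concavity the slope at `η` is at least that of the chord to the midpoint of `[η, 1]`, while
  -- it is at most the zero slope at the wall. The chord has length `(1 - η) / 2` and drops by at
  -- most `B`.
  have hm : (1 + η) / 2 ∈ Ico (0 : ℝ) 1 := ⟨by linarith [hη.1], by linarith⟩
  have hlt : η < (1 + η) / 2 := by linarith
  obtain ⟨z, hz, hzeq⟩ := exists_hasDerivAt_eq_slope (wbar ξ) (dY (fun _ => wbar) 0 ξ) hlt
    (fun r hr => (hd r ⟨hη.1.trans hr.1, hr.2.trans_lt hm.2⟩).continuousWithinAt.mono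
      fun q hq => hη.1.trans hq.1)
    (fun r hr => (hd r ⟨hη.1.trans hr.1.le, hr.2.trans hm.2⟩).hasDerivAt
      (Ici_mem_nhds (hη.1.trans_lt hr.1)))
  have h1 := hanti hη ⟨hη.1.trans hz.1.le, hz.2.trans hm.2⟩ hz.1.le
  rw [hzeq, div_le_iff₀ (by linarith)] at h1
  have h2 : 0 < wbar ξ ((1 + η) / 2) := hs.w_pos le_rfl hξ hm
  rw [abs_of_nonpos hnp, le_div_iff₀ hx]
  linarith [hB η hη]

end

/-! ### Passing between `w` and the velocity `u` -/

section

variable {X : ℝ} {ubar wbar : ℝ → ℝ → ℝ} {u w : ℝ → ℝ → ℝ → ℝ} {t x y : ℝ}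

lemma IsOleinikSolution.continuousOn_slice_w (h : IsOleinikSolution X u w) (ht : 0 ≤ t)
    (hx : x ∈ Icc 0 X) : ContinuousOn (w t x) (Ico 0 1) :=
  fun _ hη => (h.hasDerivWithinAt_w ht hx hη).continuousWithinAt.mono fun _ hs => hs.1

/-- The inversion formula `y = ∫₀^{u(y)} dη / w(η)` of the Crocco transform. -/
lemma IsOleinikSolution.integral_inv_w (h : IsOleinikSolution X u w) (ht : 0 ≤ t)
    (hx : x ∈ Icc 0 X) (hy : 0 ≤ y) : ∫ s in (0 : ℝ)..u t x y, (w t x s)⁻¹ = y := by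
  have hsub : uIcc 0 y ⊆ Ici 0 := by rw [uIcc_of_le hy]; exact Icc_subset_Ici_self
  have key := intervalIntegral.integral_comp_mul_deriv'' (a := 0) (b := y) (f := u t x)
    (f' := dY u t x) (g := fun s => (w t x s)⁻¹)
    ((h.continuousOn_slice_u ht hx).mono hsub)
    (fun z hz => (h.hasDerivWithinAt_u ht hx (by rw [min_eq_left hy] at hz; exact hz.1.le)).mono
      fun r hr => by
        rw [min_eq_left hy] at hz
        exact hz.1.le.trans (le_of_lt hr))
    (fun z hz => ((h.hasDerivWithinAt_dY_u ht hx (hsub hz)).continuousWithinAt).mono hsub)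
    (by
      refine ((h.continuousOn_slice_w ht hx).inv₀ fun s hs => (h.w_pos ht hx hs).ne').mono ?_
      rintro _ ⟨z, hz, rfl⟩
      exact h.u_mem ht hx (hsub hz))
  rw [h.u_wall ht hx] at key
  rw [← key]
  have : ∫ s in (0 : ℝ)..y, ((fun s => (w t x s)⁻¹) ∘ u t x) s * dY u t x s
      = ∫ _ in (0 : ℝ)..y, (1 : ℝ) := by
    refine intervalIntegral.integral_congr fun z hz => ?_
    simp only [Function.comp]
    rw [h.crocco t ht x hx z (hsub hz), inv_mul_cancel₀ (h.monotone t ht x hx z (hsub hz)).ne']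
  rw [this]
  simp

/-- Two profiles that reach `a₁ ≤ a₂` at the same height. -/
lemma profile_gap {w₁ w₂ : ℝ → ℝ} {a₁ a₂ b B M : ℝ} (hb : 0 < b) (hM : 0 ≤ M)
    (hc₁ : ContinuousOn w₁ (Ico 0 1)) (hc₂ : ContinuousOn w₂ (Ico 0 1))
    (hl₁ : ∀ η ∈ Ico (0 : ℝ) 1, b * (1 - η) ≤ w₁ η)
    (hl₂ : ∀ η ∈ Ico (0 : ℝ) 1, b * (1 - η) ≤ w₂ η)
    (hB : ∀ η ∈ Ico (0 : ℝ) 1, w₂ η ≤ B)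
    (hd : ∀ η ∈ Ico (0 : ℝ) 1, |w₁ η - w₂ η| ≤ M) (ha₁ : 0 ≤ a₁) (ha : a₁ ≤ a₂) (ha₂ : a₂ < 1)
    (heq : ∫ s in (0 : ℝ)..a₁, (w₁ s)⁻¹ = ∫ s in (0 : ℝ)..a₂, (w₂ s)⁻¹) :
    a₂ - a₁ ≤ B * M / (b ^ 2 * (1 - a₁) ^ 2) := by
  have hpos : ∀ η ∈ Ico (0 : ℝ) 1, 0 < b * (1 - η) := fun η hη =>
    mul_pos hb (by linarith [hη.2])
  have hp₁ : ∀ η ∈ Ico (0 : ℝ) 1, 0 < w₁ η := fun η hη => (hpos η hη).trans_le (hl₁ η hη)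
  have hp₂ : ∀ η ∈ Ico (0 : ℝ) 1, 0 < w₂ η := fun η hη => (hpos η hη).trans_le (hl₂ η hη)
  have hi₁ : ContinuousOn (fun s => (w₁ s)⁻¹) (Ico 0 1) := hc₁.inv₀ fun η hη => (hp₁ η hη).ne'
  have hi₂ : ContinuousOn (fun s => (w₂ s)⁻¹) (Ico 0 1) := hc₂.inv₀ fun η hη => (hp₂ η hη).ne'
  have hintg : ∀ (g : ℝ → ℝ), ContinuousOn g (Ico 0 1) → ∀ c d, 0 ≤ c → c ≤ d → d < 1 →
      IntervalIntegrable g MeasureTheory.volume c d := fun g hg c d hc hcd hd =>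
    (hg.mono (by rw [uIcc_of_le hcd]; exact fun z hz => ⟨hc.trans hz.1, hz.2.trans_lt hd⟩)
      ).intervalIntegrable
  have hx : 0 < 1 - a₁ := by linarith
  have hB0 : 0 < B := (hp₂ a₁ ⟨ha₁, by linarith⟩).trans_le (hB a₁ ⟨ha₁, by linarith⟩)
  -- Equality of heights turns the extra piece of the second integral into the difference of the
  -- inverses on `[0, a₁]`. The left side is at least `(a₂ - a₁) / B`; the right side is first order
  -- in `M`.
  have h1 : ∫ s in a₁..a₂, (w₂ s)⁻¹ = ∫ s in (0 : ℝ)..a₁, ((w₁ s)⁻¹ - (w₂ s)⁻¹) := by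
    rw [intervalIntegral.integral_sub (hintg _ hi₁ 0 a₁ le_rfl ha₁ (by linarith))
      (hintg _ hi₂ 0 a₁ le_rfl ha₁ (by linarith)), heq, eq_sub_iff_add_eq, add_comm]
    exact intervalIntegral.integral_add_adjacent_intervals
      (hintg _ hi₂ 0 a₁ le_rfl ha₁ (by linarith)) (hintg _ hi₂ a₁ a₂ ha₁ ha ha₂)
  have h2 : (a₂ - a₁) * B⁻¹ ≤ ∫ s in a₁..a₂, (w₂ s)⁻¹ := by
    have := intervalIntegral.integral_mono_on ha (f := fun _ => B⁻¹) (g := fun s => (w₂ s)⁻¹)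
      intervalIntegrable_const (hintg _ hi₂ a₁ a₂ ha₁ ha ha₂) fun s hs => by
        have hs' : s ∈ Ico (0 : ℝ) 1 := ⟨ha₁.trans hs.1, hs.2.trans_lt ha₂⟩
        exact inv_anti₀ (hp₂ s hs') (hB s hs')
    simpa using this
  have h3 : ∫ s in (0 : ℝ)..a₁, ((w₁ s)⁻¹ - (w₂ s)⁻¹) ≤ M / (b ^ 2 * (1 - a₁) ^ 2) := by
    have hle : ∀ s ∈ Icc 0 a₁, (w₁ s)⁻¹ - (w₂ s)⁻¹ ≤ M / (b ^ 2 * (1 - a₁) ^ 2) := by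
      intro s hs
      have hs' : s ∈ Ico (0 : ℝ) 1 := ⟨hs.1, by linarith [hs.2]⟩
      have e1 : b * (1 - a₁) ≤ b * (1 - s) := mul_le_mul_of_nonneg_left (by linarith [hs.2]) hb.le
      have e2 : b ^ 2 * (1 - a₁) ^ 2 ≤ w₁ s * w₂ s := by
        calc b ^ 2 * (1 - a₁) ^ 2 = (b * (1 - a₁)) * (b * (1 - a₁)) := by ring
          _ ≤ w₁ s * w₂ s := mul_le_mul (e1.trans (hl₁ s hs')) (e1.trans (hl₂ s hs'))
              (by positivity) (hp₁ s hs').le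
      rw [inv_sub_inv (hp₁ s hs').ne' (hp₂ s hs').ne']
      have e3 := abs_le.1 (hd s hs')
      exact div_le_div₀ hM (by linarith [e3.1]) (by positivity) e2
    have := intervalIntegral.integral_mono_on ha₁ (f := fun s => (w₁ s)⁻¹ - (w₂ s)⁻¹)
      (g := fun _ => M / (b ^ 2 * (1 - a₁) ^ 2))
      (hintg _ (hi₁.sub hi₂) 0 a₁ le_rfl ha₁ (by linarith)) intervalIntegrable_const hle
    rw [intervalIntegral.integral_const, sub_zero, smul_eq_mul] at this
    exact this.trans (mul_le_of_le_one_left (by positivity) (by linarith))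
  have h4 : (a₂ - a₁) * B⁻¹ ≤ M / (b ^ 2 * (1 - a₁) ^ 2) := h2.trans (h1.trans_le h3)
  rw [← div_eq_mul_inv, div_le_iff₀ hB0] at h4
  calc a₂ - a₁ ≤ _ := h4
    _ = _ := by ring

/-- Control of `u - ū` by `w - w̄`, away from the outer flow. -/
lemma velocity_gap (hs : IsOleinikSolution X (fun _ => ubar) (fun _ => wbar))
    (h : IsOleinikSolution X u w) {b B M : ℝ} (hb : 0 < b) (hM : 0 ≤ M)
    (ht : 0 ≤ t) (hx : x ∈ Icc 0 X) (hy : 0 ≤ y)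
    (hl : ∀ η ∈ Ico (0 : ℝ) 1, b * (1 - η) ≤ w t x η)
    (hls : ∀ η ∈ Ico (0 : ℝ) 1, b * (1 - η) ≤ wbar x η)
    (hB : ∀ η ∈ Ico (0 : ℝ) 1, w t x η ≤ B) (hBs : ∀ η ∈ Ico (0 : ℝ) 1, wbar x η ≤ B)
    (hd : ∀ η ∈ Ico (0 : ℝ) 1, |w t x η - wbar x η| ≤ M) :
    |u t x y - ubar x y| ≤ B * M / (b ^ 2 * (1 - min (u t x y) (ubar x y)) ^ 2) := by
  have m1 := h.u_mem ht hx hy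
  have m2 : ubar x y ∈ Ico (0 : ℝ) 1 := hs.u_mem ht hx hy
  have i1 := h.integral_inv_w ht hx hy
  have i2 : ∫ s in (0 : ℝ)..ubar x y, (wbar x s)⁻¹ = y := hs.integral_inv_w ht hx hy
  have c1 := h.continuousOn_slice_w ht hx
  have c2 : ContinuousOn (wbar x) (Ico 0 1) := hs.continuousOn_slice_w ht hx
  rcases le_total (u t x y) (ubar x y) with hle | hle
  · rw [min_eq_left hle, abs_sub_comm, abs_of_nonneg (by linarith)]
    exact profile_gap hb hM c1 c2 hl hls hBs hd m1.1 hle m2.2 (i1.trans i2.symm)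
  · rw [min_eq_right hle, abs_of_nonneg (by linarith)]
    exact profile_gap hb hM c2 c1 hls hl hB (fun η hη => by rw [abs_sub_comm]; exact hd η hη)
      m2.1 hle m1.2 (i2.trans i1.symm)

/-- Uniform control of `u - ū` by `w - w̄`. -/
lemma velocity_gap_uniform (hs : IsOleinikSolution X (fun _ => ubar) (fun _ => wbar))
    (h : IsOleinikSolution X u w) {b B ε : ℝ} (hb : 0 < b) (hB0 : 0 < B) (hε : 0 < ε)
    (ht : 0 ≤ t) (hx : x ∈ Icc 0 X) (hy : 0 ≤ y)
    (hl : ∀ η ∈ Ico (0 : ℝ) 1, b * (1 - η) ≤ w t x η)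
    (hls : ∀ η ∈ Ico (0 : ℝ) 1, b * (1 - η) ≤ wbar x η)
    (hB : ∀ η ∈ Ico (0 : ℝ) 1, w t x η ≤ B) (hBs : ∀ η ∈ Ico (0 : ℝ) 1, wbar x η ≤ B)
    (hd : ∀ η ∈ Ico (0 : ℝ) 1, |w t x η - wbar x η| ≤ ε ^ 3 * b ^ 2 / B) :
    |u t x y - ubar x y| ≤ ε := by
  have m1 := h.u_mem ht hx hy
  have m2 : ubar x y ∈ Ico (0 : ℝ) 1 := hs.u_mem ht hx hy
  -- Away from the outer flow the gap is at most `ε³ / ε²`; otherwise both velocities lie in `(1 -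
  -- ε, 1)`.
  rcases le_or_gt ε (1 - min (u t x y) (ubar x y)) with hcase | hcase
  · have hpos := hε.trans_le hcase
    refine (velocity_gap hs h hb (by positivity) ht hx hy hl hls hB hBs hd).trans ?_
    rw [mul_div_cancel₀ _ hB0.ne', div_le_iff₀ (by positivity)]
    calc ε ^ 3 * b ^ 2 = ε * (b ^ 2 * ε ^ 2) := by ring
      _ ≤ _ := by gcongr
  · rw [abs_le]
    constructor <;> linarith [min_le_left (u t x y) (ubar x y), min_le_right (u t x y) (ubar x y),
      m1.2, m2.2, lt_min_iff.1 (by linarith : 1 - ε < min (u t x y) (ubar x y))]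

/-- On bounded heights the velocity stays away from the outer flow. -/
lemma IsOleinikSolution.exp_le_one_sub_u {μ c₀ y₀ : ℝ} (hμ : μ ∈ Ioo (0 : ℝ) (1 / 100))
    (hc₀ : 0 < c₀) (h : IsOleinikSolution X u w) (ht : 0 ≤ t) (hx : x ∈ Icc 0 X)
    (hup : ∀ η ∈ Ico (0 : ℝ) 1, w t x η ≤ c₀⁻¹ * barrier μ η) (hy : y ∈ Icc 0 y₀) :
    Real.exp (-(Real.sqrt (-Real.log μ) + y₀ / (2 * c₀)) ^ 2) ≤ 1 - u t x y := by
  -- The upper barrier says precisely that `s` grows in `y` at rate at most `1 / (2 c₀)`, so `1 - u`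
  -- decays no faster than a Gaussian.
  let s : ℝ → ℝ := fun z => Real.sqrt (-Real.log (μ * (1 - u t x z)))
  have hder : ∀ z ≥ 0, HasDerivWithinAt (fun z => z / (2 * c₀) - s z)
      (1 / (2 * c₀) - 1 / (1 - u t x z) / (2 * s z) * dY u t x z) (Ici 0) z := fun z hz =>
    ((hasDerivWithinAt_id z _).div_const _).sub
      ((hasDerivAt_sqrt_neg_log hμ (h.u_mem ht hx hz)).comp_hasDerivWithinAt z
        (h.hasDerivWithinAt_u ht hx hz))
  have hmono : MonotoneOn (fun z => z / (2 * c₀) - s z) (Ici 0) := by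
    refine monotoneOn_of_deriv_nonneg (convex_Ici 0) (fun z hz => (hder z hz).continuousWithinAt)
      (fun z hz => ?_) (fun z hz => ?_)
    · rw [interior_Ici] at hz
      exact ((hder z (le_of_lt hz)).hasDerivAt
        (Ici_mem_nhds hz)).differentiableAt.differentiableWithinAt
    · rw [interior_Ici] at hz
      have hz' : 0 ≤ z := le_of_lt hz
      rw [((hder z hz').hasDerivAt (Ici_mem_nhds hz)).deriv, sub_nonneg,
        ← h.crocco t ht x hx z hz']
      have hm := h.u_mem ht hx hz'
      have hs1 : 1 < s z := one_lt_sqrt_neg_log hμ hm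
      have hv : 0 < 1 - u t x z := by linarith [hm.2]
      calc 1 / (1 - u t x z) / (2 * s z) * w t x (u t x z)
          ≤ 1 / (1 - u t x z) / (2 * s z) * (c₀⁻¹ * ((1 - u t x z) * s z)) :=
            mul_le_mul_of_nonneg_left (hup _ hm) (by positivity)
        _ = 1 / (2 * c₀) := by field_simp
  have h1 := hmono self_mem_Ici hy.1 hy.1
  have h0 : s 0 = Real.sqrt (-Real.log μ) := by simp [s, h.u_wall ht hx]
  simp only [h0, zero_div] at h1
  have h2 : s y ≤ Real.sqrt (-Real.log μ) + y₀ / (2 * c₀) := by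
    have : y / (2 * c₀) ≤ y₀ / (2 * c₀) := by gcongr; exact hy.2
    linarith
  have hm := h.u_mem ht hx hy.1
  have hv : 0 < 1 - u t x y := by linarith [hm.2]
  have hq := neg_log_le_neg_log_mul hμ.1 hm
  have hq1 := one_lt_neg_log hμ
  have h3 : -Real.log (μ * (1 - u t x y)) ≤ (Real.sqrt (-Real.log μ) + y₀ / (2 * c₀)) ^ 2 := by
    have := pow_le_pow_left₀ (Real.sqrt_nonneg _) h2 2
    rwa [Real.sq_sqrt (by linarith)] at this
  rw [← Real.le_log_iff_exp_le hv]
  rw [Real.log_mul hμ.1.ne' hv.ne'] at h3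
  linarith

/-- Transfer of the smallness of the data from physical to Crocco variables. -/
lemma abs_data_diff_le (hX : 0 < X)
    (hs : IsOleinikSolution X (fun _ => ubar) (fun _ => wbar)) (h : IsOleinikSolution X u w)
    (hconc : ∀ τ ≥ 0, ∀ ξ ∈ Icc 0 X, ∀ η ∈ Ico (0 : ℝ) 1, dYY (fun _ => wbar) τ ξ η ≤ 0)
    {b B M κ δ : ℝ} (hb : 0 < b) (hκ : 0 < κ) (hδ : 0 ≤ δ)
    (ht : 0 ≤ t) (hx : x ∈ Icc 0 X)
    (hl : ∀ η ∈ Ico (0 : ℝ) 1, b * (1 - η) ≤ w t x η)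
    (hBs : ∀ η ∈ Ico (0 : ℝ) 1, wbar x η ≤ B)
    (hedge : ∀ η ∈ Ico (0 : ℝ) 1, 1 - η < κ → w t x η ≤ M ∧ wbar x η ≤ M)
    (hδκ : δ / (b * κ) ≤ κ / 2) (hδM : δ + 4 * B / κ * (δ / (b * κ)) ≤ M)
    (hd : ∀ y ≥ 0, |dY u t x y - dY (fun _ => ubar) t x y| ≤ δ) :
    ∀ η ∈ Ico (0 : ℝ) 1, |w t x η - wbar x η| ≤ M := by
  intro η hη
  have hwb : ∀ η ∈ Ico (0 : ℝ) 1, 0 < wbar x η := fun η hη => hs.w_pos ht hx hη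
  -- Near the edge both profiles are below `M`. Elsewhere the height `y` with `u = η` is at most `1
  -- / (b κ)`, so integrating the shear difference from the wall controls `u - ū` there.
  rcases lt_or_ge (1 - η) κ with hcase | hcase
  · have h1 := hedge η hη hcase
    rw [abs_le]
    constructor <;> linarith [h.w_pos ht hx hη, hwb η hη]
  have hB0 : 0 < B := (hwb η hη).trans_le (hBs η hη)
  obtain ⟨y, hy, rfl⟩ := h.exists_u_eq ht hx hη
  have hyle : y ≤ 1 / (b * κ) := by
    have hbd : ∀ s ∈ uIoc 0 (u t x y), ‖(w t x s)⁻¹‖ ≤ 1 / (b * κ) := by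
      intro s hs'
      rw [uIoc_of_le hη.1] at hs'
      have hs1 : s ∈ Ico (0 : ℝ) 1 := ⟨hs'.1.le, hs'.2.trans_lt hη.2⟩
      have hp := h.w_pos ht hx hs1
      rw [Real.norm_of_nonneg (inv_nonneg.2 hp.le), ← one_div]
      refine one_div_le_one_div_of_le (by positivity) (le_trans ?_ (hl s hs1))
      exact mul_le_mul_of_nonneg_left (by linarith [hs'.2]) hb.le
    have h1 := intervalIntegral.norm_integral_le_of_norm_le_const hbd
    rw [h.integral_inv_w ht hx hy, Real.norm_of_nonneg hy, sub_zero, abs_of_nonneg hη.1] at h1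
    exact h1.trans (mul_le_of_le_one_right (by positivity) hη.2.le)
  have hm2 : ubar x y ∈ Ico (0 : ℝ) 1 := hs.u_mem ht hx hy
  have hgap : |u t x y - ubar x y| ≤ δ / (b * κ) := by
    have hder : ∀ z ∈ Ici (0 : ℝ), HasDerivWithinAt (fun z => u t x z - ubar x z)
        (dY u t x z - dY (fun _ => ubar) t x z) (Ici 0) z := fun z hz =>
      (h.hasDerivWithinAt_u ht hx hz).sub (hs.hasDerivWithinAt_u ht hx hz)
    have h1 := (convex_Ici (0 : ℝ)).norm_image_sub_le_of_norm_hasDerivWithin_le hder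
      (fun z hz => hd z hz) (self_mem_Ici) (show y ∈ Ici 0 from hy)
    have h0 : ubar x 0 = 0 := hs.u_wall ht hx
    rw [h.u_wall ht hx, h0, sub_zero, sub_zero, sub_zero, Real.norm_eq_abs,
      Real.norm_of_nonneg hy] at h1
    refine h1.trans ((mul_le_mul_of_nonneg_left hyle hδ).trans_eq ?_)
    ring
  have hgap' := abs_le.1 hgap
  -- The data compare `w` at `u` with `w̄` at `ū`. The shift of argument costs a Lipschitz constant
  -- of `w̄` on `[0, 1 - κ / 2]`, which contains both velocities because they differ by at most `κ /
  -- 2`.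
  have hLip : |wbar x (u t x y) - wbar x (ubar x y)| ≤ 4 * B / κ * |u t x y - ubar x y| := by
    have hIcc : ∀ z ∈ Icc 0 (1 - κ / 2), z ∈ Ico (0 : ℝ) 1 := fun z hz =>
      ⟨hz.1, by linarith [hz.2]⟩
    refine (convex_Icc 0 (1 - κ / 2)).norm_image_sub_le_of_norm_hasDerivWithin_le
      (f := wbar x) (f' := dY (fun _ => wbar) 0 x)
      (fun z hz => (hs.hasDerivWithinAt_w le_rfl hx (hIcc z hz)).mono fun r hr => hr.1)
      (fun z hz => ?_) ⟨hm2.1, by linarith⟩ ⟨hη.1, by linarith⟩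
    refine (abs_dY_wbar_le hX hs hconc hx hBs (hIcc z hz)).trans ?_
    calc 2 * B / (1 - z) ≤ 2 * B / (κ / 2) := by
          refine div_le_div_of_nonneg_left (by positivity) (by positivity) (by linarith [hz.2])
      _ = 4 * B / κ := by field_simp; norm_num
  have hc1 := h.crocco t ht x hx y hy
  have hc2 : wbar x (ubar x y) = dY (fun _ => ubar) t x y := hs.crocco t ht x hx y hy
  have hd' := hd y hy
  rw [← hc1, ← hc2] at hd'
  calc |w t x (u t x y) - wbar x (u t x y)|
      ≤ |w t x (u t x y) - wbar x (ubar x y)| + |wbar x (ubar x y) - wbar x (u t x y)| :=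
        abs_sub_le _ _ _
    _ ≤ δ + 4 * B / κ * (δ / (b * κ)) := by
        rw [abs_sub_comm (wbar x (ubar x y))]
        exact add_le_add hd' (hLip.trans (mul_le_mul_of_nonneg_left hgap (by positivity)))
    _ ≤ M := hδM

end

/-! ### Assembly of the stability estimates -/

/-- The constants and bounds shared by all parts of the stability theorem. -/
structure CroccoBounds (X μ c₀ b B : ℝ) (ubar wbar : ℝ → ℝ → ℝ) (u w : ℝ → ℝ → ℝ → ℝ) : Prop where
  steady : IsOleinikSolution X (fun _ => ubar) (fun _ => wbar)
  unsteady : IsOleinikSolution X u w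
  concave : ∀ τ ≥ 0, ∀ ξ ∈ Icc 0 X, ∀ η ∈ Ico (0 : ℝ) 1, dYY (fun _ => wbar) τ ξ η ≤ 0
  lower_bar : ∀ ξ ∈ Icc 0 X, ∀ η ∈ Ico (0 : ℝ) 1, b * (1 - η) ≤ wbar ξ η
  lower : ∀ τ ≥ 0, ∀ ξ ∈ Icc 0 X, ∀ η ∈ Ico (0 : ℝ) 1, b * (1 - η) ≤ w τ ξ η
  barrier_bar : ∀ ξ ∈ Icc 0 X, ∀ η ∈ Ico (0 : ℝ) 1, wbar ξ η ≤ c₀⁻¹ * barrier μ η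
  barrier : ∀ τ ≥ 0, ∀ ξ ∈ Icc 0 X, ∀ η ∈ Ico (0 : ℝ) 1, w τ ξ η ≤ c₀⁻¹ * barrier μ η
  upper_bar : ∀ ξ ∈ Icc 0 X, ∀ η ∈ Ico (0 : ℝ) 1, wbar ξ η ≤ B
  upper : ∀ τ ≥ 0, ∀ ξ ∈ Icc 0 X, ∀ η ∈ Ico (0 : ℝ) 1, w τ ξ η ≤ B

lemma StabilityHyp.croccoBounds {X μ c₀ α₀ C₁ B : ℝ} {ubar wbar : ℝ → ℝ → ℝ}
    {u w : ℝ → ℝ → ℝ → ℝ} (hX : 0 < X) (hμ : μ ∈ Ioo (0 : ℝ) (1 / 100)) (hc₀ : 0 < c₀)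
    (hB : ∀ η ∈ Ico (0 : ℝ) 1, c₀⁻¹ * barrier μ η ≤ B)
    (h : StabilityHyp X μ c₀ α₀ C₁ (bConst c₀ (betaConst μ c₀) X) ubar wbar u w) :
    CroccoBounds X μ c₀ (bConst c₀ (betaConst μ c₀) X) B ubar wbar u w := by
  have up := h.unsteady.w_le_barrier hX hμ hc₀ h.data.envelope
  have ups := h.steady.w_le_barrier hX hμ hc₀ h.data_bar.envelope 0 le_rfl
  exact
    { steady := h.steady
      unsteady := h.unsteady
      concave := dYY_nonpos_of_concave hX h.steady h.concave
      lower_bar := h.steady.bConst_mul_le hX hμ hc₀ h.data_bar.envelope 0 le_rfl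
      lower := h.unsteady.bConst_mul_le hX hμ hc₀ h.data.envelope
      barrier_bar := ups
      barrier := up
      upper_bar := fun ξ hξ η hη => (ups ξ hξ η hη).trans (hB η hη)
      upper := fun τ hτ ξ hξ η hη => (up τ hτ ξ hξ η hη).trans (hB η hη) }

namespace CroccoBounds

variable {X μ c₀ b B : ℝ} {ubar wbar : ℝ → ℝ → ℝ} {u w : ℝ → ℝ → ℝ → ℝ}

/-- Orbital stability. -/
theorem orbital {ε κ δ : ℝ} (hX : 0 < X) (hb : 0 < b) (hB0 : 0 < B) (hε : 0 < ε) (hκ : 0 < κ)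
    (hδ : 0 ≤ δ) (h : CroccoBounds X μ c₀ b B ubar wbar u w)
    (hedge : ∀ η ∈ Ico (0 : ℝ) 1, 1 - η < κ → c₀⁻¹ * Prandtl.barrier μ η ≤ ε ^ 3 * b ^ 2 / B)
    (hδκ : δ / (b * κ) ≤ κ / 2)
    (hδM : δ + 4 * B / κ * (δ / (b * κ)) ≤ ε ^ 3 * b ^ 2 / B)
    (hin : ∀ t ≥ 0, ∀ y ≥ 0, |dY u t 0 y - dY (fun _ => ubar) t 0 y| ≤ δ)
    (hinit : ∀ x ∈ Icc 0 X, ∀ y ≥ 0, |dY u 0 x y - dY (fun _ => ubar) 0 x y| ≤ δ) :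
    ∀ t ≥ 0, ∀ x ∈ Icc 0 X, ∀ y ≥ 0, |u t x y - ubar x y| ≤ ε := by
  have hdata : ∀ t ≥ 0, ∀ x ∈ Icc 0 X,
      (∀ y ≥ 0, |dY u t x y - dY (fun _ => ubar) t x y| ≤ δ) →
      ∀ η ∈ Ico (0 : ℝ) 1, |w t x η - wbar x η| ≤ ε ^ 3 * b ^ 2 / B := fun t ht x hx =>
    abs_data_diff_le hX h.steady h.unsteady h.concave hb hκ hδ ht hx (h.lower t ht x hx)
      (h.upper_bar x hx) (fun η hη h1 => ⟨(h.barrier t ht x hx η hη).trans (hedge η hη h1),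
        (h.barrier_bar x hx η hη).trans (hedge η hη h1)⟩) hδκ hδM
  have hdiff := abs_diff_le_const hX h.steady h.unsteady h.concave (by positivity)
    (fun ξ hξ => hdata 0 le_rfl ξ hξ (hinit ξ hξ))
    (fun τ hτ => hdata τ hτ 0 ⟨le_rfl, hX.le⟩ (hin τ hτ))
  intro t ht x hx y hy
  exact velocity_gap_uniform h.steady h.unsteady hb hB0 hε ht hx hy (h.lower t ht x hx)
    (h.lower_bar x hx) (h.upper t ht x hx) (h.upper_bar x hx) (hdiff t ht x hx)

/-- Exponential decay of `w - w̄`. -/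
theorem exp_decay {α C₂ κ : ℝ} (hX : 0 < X) (hμ : 0 < μ) (hc₀ : 0 < c₀) (hb : 0 < b) (hC₂ : 0 < C₂)
    (hα : α ∈ Ioo (0 : ℝ) 1) (hκ : κ ≤ b ^ 2 * α * (1 - α))
    (h : CroccoBounds X μ c₀ b B ubar wbar u w)
    (hin : ∀ τ ≥ 0, ∀ η ∈ Ico (0 : ℝ) 1,
      |w τ 0 η - wbar 0 η| ≤ Real.exp (-τ * κ) * C₂ * (1 - η) ^ α) :
    ∀ τ ≥ 0, ∀ ξ ∈ Icc 0 X, ∀ η ∈ Ico (0 : ℝ) 1, |w τ ξ η - wbar ξ η|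
      ≤ (C₂ + c₀⁻¹ * (μ ^ (-(1 - α)) / Real.sqrt (2 * (1 - α)))) * Real.exp (-τ * κ) := by
  set D := c₀⁻¹ * (μ ^ (-(1 - α)) / Real.sqrt (2 * (1 - α))) with hD
  have hD0 : 0 ≤ D := by
    have := hμ.le
    have := hc₀.le
    positivity
  have hexp : ∀ τ, Real.exp (-(κ * τ)) = Real.exp (-τ * κ) := fun τ => by congr 1; ring
  have hrp : ∀ η ∈ Ico (0 : ℝ) 1, 0 ≤ (1 - η) ^ α := fun η hη =>
    Real.rpow_nonneg (by linarith [hη.2]) _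
  have key := abs_diff_le_exp (A := C₂ + D) (κ := κ) hX h.steady h.unsteady h.concave hb.le h.lower
    (by positivity) hα hκ ?_ ?_
  · intro τ hτ ξ hξ η hη
    refine (key τ hτ ξ hξ η hη).trans ?_
    rw [hexp]
    exact mul_le_of_le_one_right (by positivity)
      (Real.rpow_le_one (by linarith [hη.2]) (by linarith [hη.1]) hα.1.le)
  · intro ξ hξ η hη
    -- No closeness is assumed at `τ = 0`: both profiles lie between `0` and the barrier, hence so
    -- does `|w - w̄|`. This produces the summand `D` in the constant.
    have hbar : c₀⁻¹ * Prandtl.barrier μ η ≤ D * (1 - η) ^ α := by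
      rw [hD, mul_assoc]
      exact mul_le_mul_of_nonneg_left (barrier_le_rpow hμ hα.2 hη.2) (inv_nonneg.2 hc₀.le)
    have h1 := h.barrier 0 le_rfl ξ hξ η hη
    have h2 := h.barrier_bar ξ hξ η hη
    have h3 := h.unsteady.w_pos le_rfl hξ hη
    have h4 : 0 < wbar ξ η := h.steady.w_pos le_rfl hξ hη
    have h5 := mul_nonneg hC₂.le (hrp η hη)
    rw [add_mul, abs_le]
    constructor <;> linarith
  · intro τ hτ η hη
    refine (hin τ hτ η hη).trans ?_
    rw [hexp, mul_comm (Real.exp _)]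
    have := hrp η hη
    gcongr
    linarith

end CroccoBounds

end Prandtl

end

/-! ### Choice of the constants -/

theorem theorem1p2 (μ c₀ X : ℝ) (hμ : μ ∈ Set.Ioo (0 : ℝ) (1 / 100))
    (hc₀ : c₀ ∈ Set.Ioo (0 : ℝ) 1) (hX : 0 < X) :
    ∃ β > 0, ∀ α₀ ∈ Set.Ioo (0 : ℝ) 1,
      -- orbital stability
      (∀ C₁ > 0, ∀ ε > 0, ∃ δε > 0, ∀ (ubar wbar : ℝ → ℝ → ℝ) (u w : ℝ → ℝ → ℝ → ℝ),
        Prandtl.StabilityHyp X μ c₀ α₀ C₁ (Prandtl.bConst c₀ β X) ubar wbar u w →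
        (∀ t ≥ 0, ∀ y ≥ 0, |Prandtl.dY u t 0 y - Prandtl.dY (fun _ => ubar) t 0 y| ≤ δε) →
        (∀ x ∈ Set.Icc 0 X, ∀ y ≥ 0,
          |Prandtl.dY u 0 x y - Prandtl.dY (fun _ => ubar) 0 x y| ≤ δε) →
        ∀ t ≥ 0, ∀ x ∈ Set.Icc 0 X, ∀ y ≥ 0, |ubar x y - u t x y| ≤ ε) ∧
      -- asymptotic stability: exponential rate on bounded sets of `y`
      (∀ C₂ > 0, ∀ y₀ > 0, ∃ C > 0, ∀ C₁ > 0,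
        ∀ β₀ ∈ Set.Ioo 0 (Prandtl.bConst c₀ β X ^ 2 * α₀ * (1 - α₀)),
        ∀ (ubar wbar : ℝ → ℝ → ℝ) (u w : ℝ → ℝ → ℝ → ℝ),
        Prandtl.StabilityHyp X μ c₀ α₀ C₁ (Prandtl.bConst c₀ β X) ubar wbar u w →
        (∀ τ ≥ 0, ∀ η ∈ Set.Ico (0 : ℝ) 1,
          |w τ 0 η - wbar 0 η| ≤ Real.exp (-τ * β₀) * C₂ * (1 - η) ^ α₀) →
        ∀ t ≥ 0, ∀ x ∈ Set.Icc 0 X, ∀ y ∈ Set.Icc 0 y₀,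
          |u t x y - ubar x y| ≤ C * Real.exp (-t * β₀)) ∧
      -- asymptotic stability: uniform convergence on `[0, X] × [0, ∞)`
      (∀ C₂ > 0, ∀ C₁ > 0, ∀ β₀ ∈ Set.Ioo 0 (Prandtl.bConst c₀ β X ^ 2 * α₀ * (1 - α₀)),
        ∀ (ubar wbar : ℝ → ℝ → ℝ) (u w : ℝ → ℝ → ℝ → ℝ),
        Prandtl.StabilityHyp X μ c₀ α₀ C₁ (Prandtl.bConst c₀ β X) ubar wbar u w →
        (∀ τ ≥ 0, ∀ η ∈ Set.Ico (0 : ℝ) 1,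
          |w τ 0 η - wbar 0 η| ≤ Real.exp (-τ * β₀) * C₂ * (1 - η) ^ α₀) →
        TendstoUniformlyOn (fun (t : ℝ) (p : ℝ × ℝ) => u t p.1 p.2) (fun p => ubar p.1 p.2)
          Filter.atTop (Set.Icc 0 X ×ˢ Set.Ici 0)) := by

  have hc := hc₀.1
  have hci : 0 < c₀⁻¹ := inv_pos.2 hc
  obtain ⟨B₀, hB₀, hbB₀⟩ := Prandtl.exists_barrier_bound hμ.1
  obtain ⟨B, hB, hbB⟩ : ∃ B > 0, ∀ η ∈ Set.Ico (0 : ℝ) 1, c₀⁻¹ * Prandtl.barrier μ η ≤ B :=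
    ⟨c₀⁻¹ * B₀, by positivity, fun η hη => mul_le_mul_of_nonneg_left (hbB₀ η hη) hci.le⟩
  refine ⟨Prandtl.betaConst μ c₀, Prandtl.betaConst_pos hμ hc, fun α₀ hα₀ => ?_⟩
  have hb := Prandtl.bConst_pos (Prandtl.betaConst μ c₀) X hc
  have hbounds := fun (C₁ : ℝ) (ubar wbar : ℝ → ℝ → ℝ) (u w : ℝ → ℝ → ℝ → ℝ)
      (h : Prandtl.StabilityHyp X μ c₀ α₀ C₁
        (Prandtl.bConst c₀ (Prandtl.betaConst μ c₀) X) ubar wbar u w) =>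
    h.croccoBounds hX hμ hc hbB
  generalize Prandtl.bConst c₀ (Prandtl.betaConst μ c₀) X = b at hb hbounds ⊢
  have hDpos : ∀ C₂ > 0, 0 < C₂ + c₀⁻¹ * (μ ^ (-(1 - α₀)) / Real.sqrt (2 * (1 - α₀))) := by
    intro C₂ hC₂
    have := hμ.1
    positivity
  refine ⟨?_, ?_, ?_⟩
  · intro C₁ _ ε hε
    have hM : 0 < ε ^ 3 * b ^ 2 / B := by positivity
    obtain ⟨κ, hκ, hedge⟩ : ∃ κ > 0, ∀ η ∈ Set.Ico (0 : ℝ) 1, 1 - η < κ →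
        c₀⁻¹ * Prandtl.barrier μ η ≤ ε ^ 3 * b ^ 2 / B := by
      have h1 := (Prandtl.tendsto_barrier hμ.1).const_mul c₀⁻¹
      rw [mul_zero] at h1
      obtain ⟨κ, hκ, hsub⟩ := Metric.mem_nhdsWithin_iff.1 (h1.eventually (gt_mem_nhds hM))
      refine ⟨κ, hκ, fun η hη hlt => le_of_lt (hsub ⟨?_, hη⟩)⟩
      rw [Metric.mem_ball, dist_comm, Real.dist_eq, abs_of_pos (by linarith [hη.2])]
      exact hlt
    have hL : 0 < 1 + 4 * B / κ / (b * κ) := by positivity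
    -- The first entry keeps the velocity gap below `κ / 2`; the second keeps the total error, shear
    -- plus Lipschitz shift, below `ε³ b² / B`.
    refine ⟨min (b * κ ^ 2 / 2) (ε ^ 3 * b ^ 2 / B / (1 + 4 * B / κ / (b * κ))),
      by positivity, ?_⟩
    intro ubar wbar u w h hin hinit t ht x hx y hy
    rw [abs_sub_comm]
    refine (hbounds C₁ ubar wbar u w h).orbital hX hb hB hε hκ (by positivity) hedge ?_ ?_
      hin hinit t ht x hx y hy
    · rw [div_le_iff₀ (by positivity)]
      refine (min_le_left _ _).trans_eq ?_
      ring
    · have h1 := min_le_right (b * κ ^ 2 / 2) (ε ^ 3 * b ^ 2 / B / (1 + 4 * B / κ / (b * κ)))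
      rw [le_div_iff₀ hL] at h1
      refine le_trans (le_of_eq ?_) h1
      ring
  · intro C₂ hC₂ y₀ _
    have hA := hDpos C₂ hC₂
    set A := C₂ + c₀⁻¹ * (μ ^ (-(1 - α₀)) / Real.sqrt (2 * (1 - α₀))) with hAdef
    have hκ := Real.exp_pos (-(Real.sqrt (-Real.log μ) + y₀ / (2 * c₀)) ^ 2)
    set κ := Real.exp (-(Real.sqrt (-Real.log μ) + y₀ / (2 * c₀)) ^ 2) with hκdef
    -- The velocity gap is `B M / (b² (1 - min)²)` with `M = A e^{-β₀ t}` and `1 - min ≥ κ`. None of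
    -- `A`, `B`, `b`, `κ` involves `β₀` or `C₁`.
    refine ⟨B * A / (b ^ 2 * κ ^ 2), by positivity, ?_⟩
    intro C₁ _ β₀ hβ₀ ubar wbar u w h hin t ht x hx y hy
    have hcb := hbounds C₁ ubar wbar u w h
    have hdiff := hcb.exp_decay hX hμ.1 hc hb hC₂ hα₀ hβ₀.2.le hin t ht x hx
    rw [← hAdef] at hdiff
    have h1 := hcb.unsteady.exp_le_one_sub_u hμ hc ht hx (hcb.barrier t ht x hx) hy
    have hmin : κ ≤ 1 - min (u t x y) (ubar x y) := by
      linarith [min_le_left (u t x y) (ubar x y)]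
    have hmin0 := hκ.trans_le hmin
    refine (Prandtl.velocity_gap hcb.steady hcb.unsteady hb (by positivity) ht hx hy.1
      (hcb.lower t ht x hx) (hcb.lower_bar x hx) (hcb.upper t ht x hx) (hcb.upper_bar x hx)
      hdiff).trans ?_
    calc B * (A * Real.exp (-t * β₀)) / (b ^ 2 * (1 - min (u t x y) (ubar x y)) ^ 2)
        ≤ B * (A * Real.exp (-t * β₀)) / (b ^ 2 * κ ^ 2) := by gcongr
      _ = B * A / (b ^ 2 * κ ^ 2) * Real.exp (-t * β₀) := by ring
  · intro C₂ hC₂ C₁ _ β₀ hβ₀ ubar wbar u w h hin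
    have hcb := hbounds C₁ ubar wbar u w h
    have hdiff := hcb.exp_decay hX hμ.1 hc hb hC₂ hα₀ hβ₀.2.le hin
    rw [Metric.tendstoUniformlyOn_iff]
    intro ε hε
    have hlim : Filter.Tendsto (fun t : ℝ => (C₂ + c₀⁻¹ * (μ ^ (-(1 - α₀))
        / Real.sqrt (2 * (1 - α₀)))) * Real.exp (-t * β₀)) Filter.atTop (nhds 0) := by
      have h1 : Filter.Tendsto (fun t : ℝ => -t * β₀) Filter.atTop Filter.atBot :=
        Filter.tendsto_neg_atTop_atBot.atBot_mul_const hβ₀.1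
      simpa using (Real.tendsto_exp_atBot.comp h1).const_mul
        (C₂ + c₀⁻¹ * (μ ^ (-(1 - α₀)) / Real.sqrt (2 * (1 - α₀))))
    -- Uniform convergence asks for a strict inequality, so the non-strict gap bound is applied with
    -- `ε / 2`.
    have hM : 0 < (ε / 2) ^ 3 * b ^ 2 / B := by positivity
    filter_upwards [hlim.eventually (gt_mem_nhds hM), Filter.eventually_ge_atTop 0] with t htM ht p hp
    rw [dist_comm, Real.dist_eq]
    refine lt_of_le_of_lt ?_ (half_lt_self hε)
    exact Prandtl.velocity_gap_uniform hcb.steady hcb.unsteady hb hB (by positivity) ht hp.1 hp.2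
      (hcb.lower t ht _ hp.1) (hcb.lower_bar _ hp.1) (hcb.upper t ht _ hp.1)
      (hcb.upper_bar _ hp.1) fun η hη => (hdiff t ht _ hp.1 η hη).trans htM.le
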